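/- **One Radius Theorem.** Let $k\ge 1$ be an integer, $\rho>0$ and $\kappa=-1/\rho^2$. Consider the ball model $\{m\in\mathbb{R}^{k+1}: |m|<\rho\}$, with metric $\frac{2\rho^2}{\rho^2-|m|^2}|dm|$, of the $(k+1)$-dimensional hyperbolic space of constant sectional curvature $\kappa$, and let $r=\rho\ln\frac{\rho+|m|}{\rho-|m|}$ be the hyperbolic distance from the origin. A radial eigenfunction with eigenvalue $\lambda\in\mathbb{C}$ is a function $\varphi:[0,\infty)\to\mathbb{C}$ of $r$ with $\triangle\varphi+\lambda\varphi=0$, where $\triangle$ is the hyperbolic Laplacian; on functions of $r$ it is $$\triangle\varphi(r)=\varphi''(r)+\frac{k}{\rho}\coth\left(\frac{r}{\rho}\right)\varphi'(r).$$ This may be understood either as: $m\mapsto\varphi(r(m))$ is $C^2$ on the ball and satisfies the eigenvalue equation for the Laplace–Beltrami operator there; or as: $\varphi$ is continuous at $0$, twice differentiable on $(0,\infty)$ and satisfies $\varphi''+\frac{k}{\rho}\coth(\frac r\rho)\varphi'+\lambda\varphi=0$ for all $r>0$. Let $\mu\ne\nu$ be complex numbers and let $\varphi_\mu,\varphi_\nu$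 be radial eigenfunctions with eigenvalues $\mu$ and $\nu$ and with $\varphi_\mu(0)=\varphi_\nu(0)=1$. Let $\alpha,\beta\in\mathbb{C}$ be any numbers with $$\mu=-\kappa(\alpha k-\alpha^2),\qquad \nu=-\kappa(\beta k-\beta^2),$$ and let $p=\max\{|\mathrm{Im}\,\alpha|,|\mathrm{Im}\,\beta|\}$. Then $\varphi_\mu(r)\ne\varphi_\nu(r)$ for every $r\in(0,\pi\rho/(2p)]$, where this interval is read as $(0,\infty)$ if $p=0$. In particular, if $\mu$ and $\nu$ are real and $\mu,\nu\le-\kappa k^2/4$, then $\varphi_\mu(r)\ne\varphi_\nu(r)$ for every $r>0$. -/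

import Mathlib

noncomputable section

/-- Conformal factor `2ρ²/(ρ² - |m|²)` of the ball model `{|m| < ρ} ⊆ ℝ^(k+1)` of hyperbolic
space of curvature `-1/ρ²`: the metric is `g = (conformalFactor)² |dm|²`. -/
def conformalFactor {k : ℕ} (ρ : ℝ) (m : EuclideanSpace ℝ (Fin (k + 1))) : ℝ :=
  2 * ρ ^ 2 / (ρ ^ 2 - ‖m‖ ^ 2)

/-- Partial derivative in the `i`-th Euclidean coordinate. -/
def partialDeriv {k : ℕ} (i : Fin (k + 1)) (f : EuclideanSpace ℝ (Fin (k + 1)) → ℂ)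
    (m : EuclideanSpace ℝ (Fin (k + 1))) : ℂ :=
  fderiv ℝ f m (EuclideanSpace.single i 1)

/-- The Laplace–Beltrami operator `(det g)^(-1/2) ∑ᵢ ∂ᵢ ((det g)^(1/2) gⁱⁱ ∂ᵢ f)` of the ball model
of dimension `k + 1`; with `c` the conformal factor, `(det g)^(1/2) = c^(k+1)`, `gⁱⁱ = c⁻²`. -/
def hyperbolicLaplacian {k : ℕ} (ρ : ℝ) (f : EuclideanSpace ℝ (Fin (k + 1)) → ℂ)
    (m : EuclideanSpace ℝ (Fin (k + 1))) : ℂ :=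
  (((conformalFactor ρ m ^ (k + 1))⁻¹ : ℝ) : ℂ) *
    ∑ i : Fin (k + 1), partialDeriv i
      (fun x => ((conformalFactor ρ x ^ (k + 1) * (conformalFactor ρ x ^ 2)⁻¹ : ℝ) : ℂ)
        * partialDeriv i f x) m

/-- Hyperbolic distance from the origin in the ball model. -/
def hyperbolicRadius {k : ℕ} (ρ : ℝ) (m : EuclideanSpace ℝ (Fin (k + 1))) : ℝ :=
  ρ * Real.log ((ρ + ‖m‖) / (ρ - ‖m‖))

/-- `φ`, as a function of the hyperbolic distance `r` from the origin, is a radial eigenfunction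
of the Laplacian of the ball model: `Δ f + μ f = 0` for `f m = φ (r m)`. -/
structure IsRadialEigenfunction (k : ℕ) (ρ : ℝ) (μ : ℂ) (φ : ℝ → ℂ) : Prop where
  contDiffOn : ContDiffOn ℝ 2
    (fun m : EuclideanSpace ℝ (Fin (k + 1)) => φ (hyperbolicRadius ρ m)) (Metric.ball 0 ρ)
  eigen : ∀ m ∈ Metric.ball (0 : EuclideanSpace ℝ (Fin (k + 1))) ρ,
    hyperbolicLaplacian ρ (fun x => φ (hyperbolicRadius ρ x)) m + μ * φ (hyperbolicRadius ρ m) = 0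

/-- The hyperbolic Laplacian on radial functions in geodesic polar coordinates:
`φ'' + (k/ρ) coth(r/ρ) φ'`. -/
def polarLaplacian (k : ℕ) (ρ : ℝ) (φ : ℝ → ℂ) (r : ℝ) : ℂ :=
  deriv (deriv φ) r +
    ((k / ρ * (Real.cosh (r / ρ) / Real.sinh (r / ρ)) : ℝ) : ℂ) * deriv φ r

/-- `φ : [0, ∞) → ℂ` is a radial eigenfunction in geodesic polar coordinates. The coefficient
`coth (r/ρ)` is singular at `r = 0`; there only continuity is required. -/
structure IsPolarEigenfunction (k : ℕ) (ρ : ℝ) (μ : ℂ) (φ : ℝ → ℂ) : Prop where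
  continuousWithinAt_zero : ContinuousWithinAt φ (Set.Ici 0) 0
  differentiableOn : DifferentiableOn ℝ φ (Set.Ioi 0)
  differentiableOn_deriv : DifferentiableOn ℝ (deriv φ) (Set.Ioi 0)
  eigen : ∀ r : ℝ, 0 < r → polarLaplacian k ρ φ r + μ * φ r = 0

/-- The interval `(0, πρ/(2p)]`, read as `(0, ∞)` when `p = 0`. -/
def oneRadiusInterval (ρ p : ℝ) : Set ℝ :=
  if p = 0 then Set.Ioi 0 else Set.Ioc 0 (Real.pi * ρ / (2 * p))

end

/-! ### The argument of a product of two hyperbolic sines -/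

/-! After rescaling to curvature `-1` and writing `t = r/ρ`, let `P = 1/X` with `X = cosh t + sinh t
cos θ` be the Poisson kernel. Every power `P^α` is an eigenfunction of the full Laplacian, so its
mean over the sphere, with angular density `sin^(k-1) θ`, is a radial eigenfunction with eigenvalue
`αk - α²`. Uniqueness (`IsPolarEigenfunction.eq_zero`) identifies the normalised mean with `φ`.
Since `k - α` gives the same eigenvalue, adding the two means writes `φ(t)` as a positive weighted
mean of `cosh ((α - k/2) L)`, where `L = log X` and the weight `X^(-k/2) sin^(k-1) θ` does not
depend on `α` (`IsPolarEigenfunction.integral_representation`).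

If the two eigenfunctions agreed at `t`, the weighted integral of the difference of the two
hyperbolic cosines would vanish. That difference is `2 sinh (zL) sinh (wL)` with `z = (α + β - k)/2`
and `w = (α - β)/2`, both nonzero because the eigenvalues differ. Now `|L| ≤ t`, and the hypothesis
on `r` gives `|Im z| t, |Im w| t ≤ π/2`, so each factor stays in one closed quadrant for `L ∈ [0,
t]`. The product is even in `L`, hence it stays in one closed half-plane, and in its interior for `0
< |L| < t` (`exists_sinhProductInHalfPlane`). Its weighted integral therefore cannot vanish.

Uniqueness is delicate because only continuity is assumed at the singular point `0`: first `φ' → 0`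
is recovered there (`IsPolarEigenfunction.norm_deriv_le`), then an energy estimate applies. The
formulation on the ball reduces to the polar one by computing the Laplacian of a radial function
(`hyperbolicLaplacian_radial`). -/

theorem sinh_mul_ofReal_re (z : ℂ) (s : ℝ) :
    (Complex.sinh (z * s)).re = Real.sinh (z.re * s) * Real.cos (z.im * s) := by
  have h : z * s = ((z.re * s : ℝ) : ℂ) + ((z.im * s : ℝ) : ℂ) * Complex.I := by
    apply Complex.ext <;> simp
  rw [h, Complex.sinh_add, Complex.cosh_mul_I, Complex.sinh_mul_I]
  simp [← Complex.ofReal_sinh, ← Complex.ofReal_cosh, ← Complex.ofReal_sin, ← Complex.ofReal_cos,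
    -Complex.ofReal_mul]

theorem sinh_mul_ofReal_im (z : ℂ) (s : ℝ) :
    (Complex.sinh (z * s)).im = Real.cosh (z.re * s) * Real.sin (z.im * s) := by
  have h : z * s = ((z.re * s : ℝ) : ℂ) + ((z.im * s : ℝ) : ℂ) * Complex.I := by
    apply Complex.ext <;> simp
  rw [h, Complex.sinh_add, Complex.cosh_mul_I, Complex.sinh_mul_I]
  simp [← Complex.ofReal_sinh, ← Complex.ofReal_cosh, ← Complex.ofReal_sin, ← Complex.ofReal_cos,
    -Complex.ofReal_mul]

/-- On `[0, t]` the product `sinh (z s) sinh (w s)` stays in the closed half-plane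
`{ζ | 0 ≤ Re (u ζ)}`, and in its interior on `(0, t)`. -/
def SinhProductInHalfPlane (z w : ℂ) (t : ℝ) (u : ℂ) : Prop :=
  (∀ s : ℝ, 0 ≤ s → s ≤ t → 0 ≤ (u * (Complex.sinh (z * s) * Complex.sinh (w * s))).re) ∧
    ∀ s : ℝ, 0 < s → s < t → 0 < (u * (Complex.sinh (z * s) * Complex.sinh (w * s))).re

theorem SinhProductInHalfPlane.of_neg_left {z w u : ℂ} {t : ℝ}
    (h : SinhProductInHalfPlane (-z) w t u) : SinhProductInHalfPlane z w t (-u) := by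
  simpa [SinhProductInHalfPlane, Complex.sinh_neg] using h

theorem SinhProductInHalfPlane.of_neg_right {z w u : ℂ} {t : ℝ}
    (h : SinhProductInHalfPlane z (-w) t u) : SinhProductInHalfPlane z w t (-u) := by
  simpa [SinhProductInHalfPlane, Complex.sinh_neg] using h

theorem SinhProductInHalfPlane.of_conj {z w u : ℂ} {t : ℝ}
    (h : SinhProductInHalfPlane (starRingEnd ℂ z) (starRingEnd ℂ w) t u) :
    SinhProductInHalfPlane z w t (starRingEnd ℂ u) := by
  have key : ∀ s : ℝ, (starRingEnd ℂ u * (Complex.sinh (z * s) * Complex.sinh (w * s))).re =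
      (u * (Complex.sinh (starRingEnd ℂ z * s) * Complex.sinh (starRingEnd ℂ w * s))).re := by
    intro s
    rw [← Complex.conj_re (u * _)]
    simp only [map_mul, ← Complex.sinh_conj, Complex.conj_conj, Complex.conj_ofReal]
  simpa only [SinhProductInHalfPlane, key] using h

/-- Both factors lie in the closed first quadrant, so their product lies in the upper half-plane and
`u = -I` works. The exceptions, where the product is real, are `z`, `w` both imaginary (`u = -1`) or
both real (`u = 1`). -/
theorem exists_sinhProductInHalfPlane_of_im_nonneg {z w : ℂ} (hz : z ≠ 0) (hw : w ≠ 0) {t : ℝ}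
    (hzt : z.im * t ≤ Real.pi / 2) (hwt : w.im * t ≤ Real.pi / 2)
    (hzre : 0 ≤ z.re) (hwre : 0 ≤ w.re) (hzim : 0 ≤ z.im) (hwim : 0 ≤ w.im) :
    ∃ u, SinhProductInHalfPlane z w t u := by
  have hpi := Real.pi_pos
  have sh0 : ∀ x s : ℝ, 0 ≤ x → 0 ≤ s → 0 ≤ Real.sinh (x * s) := fun x s hx hs =>
    Real.sinh_nonneg_iff.2 (mul_nonneg hx hs)
  have sh1 : ∀ x s : ℝ, 0 < x → 0 < s → 0 < Real.sinh (x * s) := fun x s hx hs =>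
    Real.sinh_pos_iff.2 (mul_pos hx hs)
  have sn0 : ∀ y s : ℝ, 0 ≤ y → y * t ≤ Real.pi / 2 → 0 ≤ s → s ≤ t → 0 ≤ Real.sin (y * s) :=
    fun y s hy hyt hs hst => Real.sin_nonneg_of_nonneg_of_le_pi (mul_nonneg hy hs)
      (by nlinarith [mul_le_mul_of_nonneg_left hst hy])
  have sn1 : ∀ y s : ℝ, 0 < y → y * t ≤ Real.pi / 2 → 0 < s → s < t → 0 < Real.sin (y * s) :=
    fun y s hy hyt hs hst => Real.sin_pos_of_pos_of_lt_pi (mul_pos hy hs)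
      (by nlinarith [mul_lt_mul_of_pos_left hst hy])
  have cs0 : ∀ y s : ℝ, 0 ≤ y → y * t ≤ Real.pi / 2 → 0 ≤ s → s ≤ t → 0 ≤ Real.cos (y * s) :=
    fun y s hy hyt hs hst => Real.cos_nonneg_of_neg_pi_div_two_le_of_le
      (by nlinarith [mul_nonneg hy hs]) (by nlinarith [mul_le_mul_of_nonneg_left hst hy])
  have cs1 : ∀ y s : ℝ, 0 ≤ y → y * t ≤ Real.pi / 2 → 0 < s → s < t → 0 < Real.cos (y * s) := by
    intro y s hy hyt hs hst
    rcases hy.eq_or_lt with rfl | hy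
    · simp
    · exact Real.cos_pos_of_mem_Ioo ⟨by nlinarith [mul_pos hy hs],
        by nlinarith [mul_lt_mul_of_pos_left hst hy]⟩
  by_cases hre : z.re = 0 ∧ w.re = 0
  · have hz' : 0 < z.im := hzim.lt_of_ne fun h => hz (Complex.ext hre.1 h.symm)
    have hw' : 0 < w.im := hwim.lt_of_ne fun h => hw (Complex.ext hre.2 h.symm)
    refine ⟨-1, fun s hs hst => ?_, fun s hs hst => ?_⟩
    · have := mul_nonneg (sn0 _ s hzim hzt hs hst) (sn0 _ s hwim hwt hs hst)
      simpa [Complex.mul_re, sinh_mul_ofReal_re, sinh_mul_ofReal_im, hre] using this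
    · have := mul_pos (sn1 _ s hz' hzt hs hst) (sn1 _ s hw' hwt hs hst)
      simpa [Complex.mul_re, sinh_mul_ofReal_re, sinh_mul_ofReal_im, hre] using this
  by_cases him : z.im = 0 ∧ w.im = 0
  · have hz' : 0 < z.re := hzre.lt_of_ne fun h => hz (Complex.ext h.symm him.1)
    have hw' : 0 < w.re := hwre.lt_of_ne fun h => hw (Complex.ext h.symm him.2)
    refine ⟨1, fun s hs hst => ?_, fun s hs hst => ?_⟩
    · have := mul_nonneg (sh0 _ s hzre hs) (sh0 _ s hwre hs)
      simpa [Complex.mul_re, sinh_mul_ofReal_re, sinh_mul_ofReal_im, him] using this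
    · have := mul_pos (sh1 _ s hz' hs) (sh1 _ s hw' hs)
      simpa [Complex.mul_re, sinh_mul_ofReal_re, sinh_mul_ofReal_im, him] using this
  have key : ∀ s : ℝ, (-Complex.I * (Complex.sinh (z * s) * Complex.sinh (w * s))).re =
      (Real.sinh (z.re * s) * Real.cos (z.im * s)) * (Real.cosh (w.re * s) * Real.sin (w.im * s)) +
      (Real.cosh (z.re * s) * Real.sin (z.im * s)) *
        (Real.sinh (w.re * s) * Real.cos (w.im * s)) := by
    intro s
    simp [Complex.mul_im, sinh_mul_ofReal_re, sinh_mul_ofReal_im]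
  have h1 : ∀ s : ℝ, 0 ≤ s → s ≤ t → 0 ≤ (Real.sinh (z.re * s) * Real.cos (z.im * s)) *
      (Real.cosh (w.re * s) * Real.sin (w.im * s)) := fun s hs hst =>
    mul_nonneg (mul_nonneg (sh0 _ s hzre hs) (cs0 _ s hzim hzt hs hst))
      (mul_nonneg (Real.cosh_pos _).le (sn0 _ s hwim hwt hs hst))
  have h2 : ∀ s : ℝ, 0 ≤ s → s ≤ t → 0 ≤ (Real.cosh (z.re * s) * Real.sin (z.im * s)) *
      (Real.sinh (w.re * s) * Real.cos (w.im * s)) := fun s hs hst =>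
    mul_nonneg (mul_nonneg (Real.cosh_pos _).le (sn0 _ s hzim hzt hs hst))
      (mul_nonneg (sh0 _ s hwre hs) (cs0 _ s hwim hwt hs hst))
  refine ⟨-Complex.I, fun s hs hst => ?_, fun s hs hst => ?_⟩
  · rw [key]
    exact add_nonneg (h1 s hs hst) (h2 s hs hst)
  · rw [key]
    -- Of the two nonnegative summands at least one is positive, because `z` and `w` are nonzero and
    -- do not lie on a common axis.
    by_cases hc : 0 < z.re ∧ 0 < w.im
    · exact add_pos_of_pos_of_nonneg (mul_pos (mul_pos (sh1 _ s hc.1 hs) (cs1 _ s hzim hzt hs hst))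
        (mul_pos (Real.cosh_pos _) (sn1 _ s hc.2 hwt hs hst))) (h2 s hs.le hst.le)
    · have hc' : 0 < z.im ∧ 0 < w.re := by
        have e1 : ¬(z.re = 0 ∧ z.im = 0) := fun h => hz (Complex.ext h.1 h.2)
        have e2 : ¬(w.re = 0 ∧ w.im = 0) := fun h => hw (Complex.ext h.1 h.2)
        grind
      exact add_pos_of_nonneg_of_pos (h1 s hs.le hst.le) (mul_pos (mul_pos (Real.cosh_pos _)
        (sn1 _ s hc'.1 hzt hs hst)) (mul_pos (sh1 _ s hc'.2 hs) (cs1 _ s hwim hwt hs hst)))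

/-- One factor lies in the first quadrant and the other in the fourth, so the product has
nonnegative real part. Strictness needs both real parts positive; an imaginary `z` or `w` is moved
to the previous case by symmetry. -/
theorem exists_sinhProductInHalfPlane_of_im_nonpos {z w : ℂ} (hz : z ≠ 0) (hw : w ≠ 0) {t : ℝ}
    (hzt : z.im * t ≤ Real.pi / 2) (hwt : -w.im * t ≤ Real.pi / 2)
    (hzre : 0 ≤ z.re) (hwre : 0 ≤ w.re) (hzim : 0 ≤ z.im) (hwim : w.im ≤ 0) :
    ∃ u, SinhProductInHalfPlane z w t u := by
  by_cases hwre' : w.re = 0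
  · obtain ⟨u, hu⟩ := exists_sinhProductInHalfPlane_of_im_nonneg hz (neg_ne_zero.2 hw) hzt
      (by simpa using hwt) hzre (by simp [hwre']) hzim (by simpa using hwim)
    exact ⟨_, hu.of_neg_right⟩
  by_cases hzre' : z.re = 0
  -- For imaginary `z` one has `conj (-z) = z`, so this symmetry conjugates `w` alone.
  · obtain ⟨u, hu⟩ := exists_sinhProductInHalfPlane_of_im_nonneg (z := starRingEnd ℂ (-z))
      (w := starRingEnd ℂ w) (by simpa using hz) (by simpa using hw) (t := t)
      (by simpa using hzt) (by simpa using hwt) (by simp [hzre']) (by simpa using hwre)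
      (by simpa using hzim) (by simpa using hwim)
    exact ⟨_, hu.of_conj.of_neg_left⟩
  have hpi := Real.pi_pos
  have hzre1 : 0 < z.re := hzre.lt_of_ne' hzre'
  have hwre1 : 0 < w.re := hwre.lt_of_ne' hwre'
  have hb : ∀ y s : ℝ, 0 ≤ y → y * t ≤ Real.pi / 2 → 0 ≤ s → s ≤ t →
      0 ≤ Real.sin (y * s) ∧ 0 ≤ Real.cos (y * s) := by
    intro y s hy hyt hs hst
    have h1 := mul_le_mul_of_nonneg_left hst hy
    have h2 := mul_nonneg hy hs
    exact ⟨Real.sin_nonneg_of_nonneg_of_le_pi h2 (by linarith),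
      Real.cos_nonneg_of_neg_pi_div_two_le_of_le (by linarith) (by linarith)⟩
  have hc : ∀ y s : ℝ, 0 ≤ y → y * t ≤ Real.pi / 2 → 0 < s → s < t → 0 < Real.cos (y * s) := by
    intro y s hy hyt hs hst
    rcases hy.eq_or_lt with rfl | hy
    · simp
    · exact Real.cos_pos_of_mem_Ioo ⟨by nlinarith [mul_pos hy hs],
        by nlinarith [mul_lt_mul_of_pos_left hst hy]⟩
  have key : ∀ s : ℝ, (1 * (Complex.sinh (z * s) * Complex.sinh (w * s))).re =
      (Real.sinh (z.re * s) * Real.cos (z.im * s)) *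
        (Real.sinh (w.re * s) * Real.cos (-w.im * s)) +
      (Real.cosh (z.re * s) * Real.sin (z.im * s)) *
        (Real.cosh (w.re * s) * Real.sin (-w.im * s)) := by
    intro s
    rw [one_mul, Complex.mul_re]
    simp only [sinh_mul_ofReal_re, sinh_mul_ofReal_im, neg_mul, Real.cos_neg, Real.sin_neg]
    ring
  have h2 : ∀ s : ℝ, 0 ≤ s → s ≤ t → 0 ≤ (Real.cosh (z.re * s) * Real.sin (z.im * s)) *
        (Real.cosh (w.re * s) * Real.sin (-w.im * s)) := fun s hs hst =>
    mul_nonneg (mul_nonneg (Real.cosh_pos _).le (hb _ s hzim hzt hs hst).1)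
      (mul_nonneg (Real.cosh_pos _).le (hb _ s (neg_nonneg.2 hwim) hwt hs hst).1)
  refine ⟨1, fun s hs hst => ?_, fun s hs hst => ?_⟩
  · rw [key]
    exact add_nonneg (mul_nonneg
      (mul_nonneg (Real.sinh_nonneg_iff.2 (mul_nonneg hzre hs)) (hb _ s hzim hzt hs hst).2)
      (mul_nonneg (Real.sinh_nonneg_iff.2 (mul_nonneg hwre hs))
        (hb _ s (neg_nonneg.2 hwim) hwt hs hst).2)) (h2 s hs hst)
  · rw [key]
    exact add_pos_of_pos_of_nonneg (mul_pos
      (mul_pos (Real.sinh_pos_iff.2 (mul_pos hzre1 hs)) (hc _ s hzim hzt hs hst))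
      (mul_pos (Real.sinh_pos_iff.2 (mul_pos hwre1 hs))
        (hc _ s (neg_nonneg.2 hwim) hwt hs hst))) (h2 s hs.le hst.le)

/-- As `sinh` is odd and commutes with conjugation, signs of `z` and `w` and a joint conjugation are
free. What remains is `z` in the first quadrant and `w` in the first or fourth. -/
theorem exists_sinhProductInHalfPlane {z w : ℂ} (hz : z ≠ 0) (hw : w ≠ 0) {t : ℝ}
    (hzt : |z.im| * t ≤ Real.pi / 2) (hwt : |w.im| * t ≤ Real.pi / 2) :
    ∃ u, SinhProductInHalfPlane z w t u := by
  wlog hzre : 0 ≤ z.re generalizing z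
  · obtain ⟨u, hu⟩ := this (z := -z) (neg_ne_zero.2 hz) (by simpa using hzt)
      (by simpa using (not_le.1 hzre).le)
    exact ⟨_, hu.of_neg_left⟩
  wlog hwre : 0 ≤ w.re generalizing w
  · obtain ⟨u, hu⟩ := this (w := -w) (neg_ne_zero.2 hw) (by simpa using hwt)
      (by simpa using (not_le.1 hwre).le)
    exact ⟨_, hu.of_neg_right⟩
  wlog hzim : 0 ≤ z.im generalizing z w
  · obtain ⟨u, hu⟩ := this (z := starRingEnd ℂ z) (w := starRingEnd ℂ w) (by simpa using hz)
      (by simpa using hzt) (by simpa using hzre) (by simpa using hw) (by simpa using hwt)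
      (by simpa using hwre) (by simpa using (not_le.1 hzim).le)
    exact ⟨_, hu.of_conj⟩
  rw [abs_of_nonneg hzim] at hzt
  rcases le_total 0 w.im with hwim | hwim
  · rw [abs_of_nonneg hwim] at hwt
    exact exists_sinhProductInHalfPlane_of_im_nonneg hz hw hzt hwt hzre hwre hzim hwim
  · rw [abs_of_nonpos hwim] at hwt
    exact exists_sinhProductInHalfPlane_of_im_nonpos hz hw hzt hwt hzre hwre hzim hwim

/-! ### Spherical means of powers of the Poisson kernel -/

theorem hasDerivAt_intervalIntegral_of_continuous {F F' : ℝ → ℝ → ℂ}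
    (hF : Continuous (Function.uncurry F)) (hF' : Continuous (Function.uncurry F'))
    (h : ∀ t θ, HasDerivAt (fun t => F t θ) (F' t θ) t) (a b t : ℝ) :
    HasDerivAt (fun t => ∫ θ in a..b, F t θ) (∫ θ in a..b, F' t θ) t := by
  obtain ⟨C, hC⟩ := ((isCompact_Icc (a := t - 1) (b := t + 1)).prod
    (isCompact_uIcc (a := a) (b := b))).exists_bound_of_continuousOn hF'.continuousOn
  refine (intervalIntegral.hasDerivAt_integral_of_dominated_loc_of_deriv_le (F := F) (F' := F')
    (s := Set.Icc (t - 1) (t + 1)) (bound := fun _ => C)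
    (Icc_mem_nhds (by linarith) (by linarith)) ?_ ?_ ?_ ?_ ?_ ?_).2
  · exact Filter.Eventually.of_forall fun s =>
      (hF.comp (Continuous.prodMk_right s)).aestronglyMeasurable
  · exact (hF.comp (Continuous.prodMk_right t)).intervalIntegrable _ _
  · exact (hF'.comp (Continuous.prodMk_right t)).aestronglyMeasurable
  · exact Filter.Eventually.of_forall fun θ hθ s hs =>
      hC (s, θ) ⟨hs, Set.uIoc_subset_uIcc hθ⟩
  · exact intervalIntegrable_const
  · exact Filter.Eventually.of_forall fun θ _ s _ => h s θ

noncomputable section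

/-- The reciprocal of the Poisson kernel of curvature `-1`, at distance `t` from the origin and
angle `π - θ` from the boundary point. -/
def invPoissonKernel (t θ : ℝ) : ℝ := Real.cosh t + Real.sinh t * Real.cos θ

/-- The derivative of `invPoissonKernel` in the radial variable. -/
def invPoissonKernelDeriv (t θ : ℝ) : ℝ := Real.sinh t + Real.cosh t * Real.cos θ

theorem exp_neg_le_invPoissonKernel {t : ℝ} (ht : 0 ≤ t) (θ : ℝ) :
    Real.exp (-t) ≤ invPoissonKernel t θ := by
  rw [← Real.cosh_sub_sinh, invPoissonKernel]
  nlinarith [Real.neg_one_le_cos θ, Real.sinh_nonneg_iff.2 ht]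

theorem invPoissonKernel_le_exp {t : ℝ} (ht : 0 ≤ t) (θ : ℝ) :
    invPoissonKernel t θ ≤ Real.exp t := by
  rw [← Real.cosh_add_sinh, invPoissonKernel]
  nlinarith [Real.cos_le_one θ, Real.sinh_nonneg_iff.2 ht]

theorem invPoissonKernel_pos (t θ : ℝ) : 0 < invPoissonKernel t θ := by
  rcases le_total 0 t with ht | ht
  · exact (Real.exp_pos _).trans_le (exp_neg_le_invPoissonKernel ht θ)
  -- The kernel is unchanged under `(t, θ) ↦ (-t, θ + π)`.
  · have h := (Real.exp_pos _).trans_le (exp_neg_le_invPoissonKernel (neg_nonneg.2 ht) (θ + Real.pi))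
    simpa [invPoissonKernel, Real.cos_add_pi] using h

/-- The logarithm is a Busemann function, hence bounded by the distance `t`. This bound is what
turns the condition on `r` into the quadrant condition. -/
theorem abs_log_invPoissonKernel_le {t : ℝ} (ht : 0 ≤ t) (θ : ℝ) :
    |Real.log (invPoissonKernel t θ)| ≤ t :=
  abs_le.2 ⟨(Real.le_log_iff_exp_le (invPoissonKernel_pos t θ)).2 (exp_neg_le_invPoissonKernel ht θ),
    (Real.log_le_iff_le_exp (invPoissonKernel_pos t θ)).2 (invPoissonKernel_le_exp ht θ)⟩

theorem Continuous.invPoissonKernel {X : Type*} [TopologicalSpace X] {f g : X → ℝ}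
    (hf : Continuous f) (hg : Continuous g) : Continuous fun x => invPoissonKernel (f x) (g x) := by
  unfold _root_.invPoissonKernel
  fun_prop

theorem Continuous.logDeriv_invPoissonKernel {X : Type*} [TopologicalSpace X] {f g : X → ℝ}
    (hf : Continuous f) (hg : Continuous g) :
    Continuous fun x => invPoissonKernelDeriv (f x) (g x) / _root_.invPoissonKernel (f x) (g x) := by
  refine Continuous.div ?_ (hf.invPoissonKernel hg) fun x => (invPoissonKernel_pos _ _).ne'
  simp only [invPoissonKernelDeriv]
  fun_prop

theorem hasDerivAt_invPoissonKernel (t θ : ℝ) :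
    HasDerivAt (fun t => invPoissonKernel t θ) (invPoissonKernelDeriv t θ) t :=
  (Real.hasDerivAt_cosh t).add ((Real.hasDerivAt_sinh t).mul_const _)

theorem hasDerivAt_invPoissonKernelDeriv (t θ : ℝ) :
    HasDerivAt (fun t => invPoissonKernelDeriv t θ) (invPoissonKernel t θ) t :=
  (Real.hasDerivAt_sinh t).add ((Real.hasDerivAt_cosh t).mul_const _)

theorem hasDerivAt_invPoissonKernel_angle (t θ : ℝ) :
    HasDerivAt (fun θ => invPoissonKernel t θ) (-(Real.sinh t * Real.sin θ)) θ := by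
  simpa [invPoissonKernel] using
    ((Real.hasDerivAt_cos θ).const_mul (Real.sinh t)).const_add (Real.cosh t)

/-- The power `α` of the Poisson kernel. -/
def poissonPow (α : ℂ) (t θ : ℝ) : ℂ := Complex.exp (-α * (Real.log (invPoissonKernel t θ) : ℂ))

theorem Continuous.poissonPow (α : ℂ) {X : Type*} [TopologicalSpace X] {f g : X → ℝ}
    (hf : Continuous f) (hg : Continuous g) : Continuous fun x => poissonPow α (f x) (g x) := by
  have h := (hf.invPoissonKernel hg).log fun x => (invPoissonKernel_pos _ _).ne'
  unfold _root_.poissonPow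
  fun_prop

theorem hasDerivAt_poissonPow (α : ℂ) (t θ : ℝ) :
    HasDerivAt (fun t => poissonPow α t θ)
      (-α * (invPoissonKernelDeriv t θ / invPoissonKernel t θ : ℝ) * poissonPow α t θ) t := by
  have h := ((hasDerivAt_invPoissonKernel t θ).log (invPoissonKernel_pos t θ).ne').ofReal_comp
  have h' := (h.const_mul (-α)).cexp
  exact h'.congr_deriv (by rw [poissonPow]; ring)

theorem hasDerivAt_poissonPow_angle (α : ℂ) (t θ : ℝ) :
    HasDerivAt (fun θ => poissonPow α t θ)
      (α * (Real.sinh t * Real.sin θ / invPoissonKernel t θ : ℝ) * poissonPow α t θ) θ := by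
  have h := ((hasDerivAt_invPoissonKernel_angle t θ).log (invPoissonKernel_pos t θ).ne').ofReal_comp
  have h' := (h.const_mul (-α)).cexp
  exact h'.congr_deriv (by rw [poissonPow, neg_div]; push_cast; ring)

/-- The kernel equals its second radial derivative, so its logarithmic derivative solves a Riccati
equation. -/
theorem hasDerivAt_invPoissonKernelDeriv_div (t θ : ℝ) :
    HasDerivAt (fun t => invPoissonKernelDeriv t θ / invPoissonKernel t θ)
      (1 - (invPoissonKernelDeriv t θ / invPoissonKernel t θ) ^ 2) t := by
  have h0 := (invPoissonKernel_pos t θ).ne'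
  refine ((hasDerivAt_invPoissonKernelDeriv t θ).div (hasDerivAt_invPoissonKernel t θ)
    h0).congr_deriv ?_
  field_simp

/-- The second radial derivative of `poissonPow`. -/
theorem hasDerivAt_deriv_poissonPow (α : ℂ) (t θ : ℝ) :
    HasDerivAt (fun t => -α * (invPoissonKernelDeriv t θ / invPoissonKernel t θ : ℝ) *
        poissonPow α t θ)
      ((-α + (α + α ^ 2) * ((invPoissonKernelDeriv t θ / invPoissonKernel t θ : ℝ) : ℂ) ^ 2) *
        poissonPow α t θ) t := by
  refine (((hasDerivAt_invPoissonKernelDeriv_div t θ).ofReal_comp.const_mul (-α)).mul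
    (hasDerivAt_poissonPow α t θ)).congr_deriv ?_
  push_cast
  ring

/-- The unnormalised mean over the `k`-sphere of the power `α` of the Poisson kernel. -/
def sphericalMean (k : ℕ) (α : ℂ) (t : ℝ) : ℂ :=
  ∫ θ in (0 : ℝ)..Real.pi, poissonPow α t θ * ((Real.sin θ ^ (k - 1) : ℝ) : ℂ)

theorem hasDerivAt_sphericalMean (k : ℕ) (α : ℂ) (t : ℝ) :
    HasDerivAt (sphericalMean k α) (∫ θ in (0 : ℝ)..Real.pi,
      -α * (invPoissonKernelDeriv t θ / invPoissonKernel t θ : ℝ) * poissonPow α t θ *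
        ((Real.sin θ ^ (k - 1) : ℝ) : ℂ)) t := by
  refine hasDerivAt_intervalIntegral_of_continuous
    (F := fun t θ => poissonPow α t θ * ((Real.sin θ ^ (k - 1) : ℝ) : ℂ))
    (F' := fun t θ => -α * (invPoissonKernelDeriv t θ / invPoissonKernel t θ : ℝ) *
      poissonPow α t θ * ((Real.sin θ ^ (k - 1) : ℝ) : ℂ)) ?_ ?_ ?_ _ _ t
  · have := Continuous.poissonPow α continuous_fst continuous_snd
    simp only [Function.uncurry_def]
    fun_prop
  · have := Continuous.poissonPow α continuous_fst continuous_snd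
    have := Continuous.logDeriv_invPoissonKernel continuous_fst continuous_snd
    simp only [Function.uncurry_def]
    exact ((continuous_const.mul (Complex.continuous_ofReal.comp this)).mul ‹_›).mul (by fun_prop)
  · exact fun t θ => (hasDerivAt_poissonPow α t θ).mul_const _

theorem hasDerivAt_deriv_sphericalMean (k : ℕ) (α : ℂ) (t : ℝ) :
    HasDerivAt (deriv (sphericalMean k α)) (∫ θ in (0 : ℝ)..Real.pi,
      (-α + (α + α ^ 2) * ((invPoissonKernelDeriv t θ / invPoissonKernel t θ : ℝ) : ℂ) ^ 2) *
        poissonPow α t θ * ((Real.sin θ ^ (k - 1) : ℝ) : ℂ)) t := by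
  have h2 := Complex.continuous_ofReal.comp
    (Continuous.logDeriv_invPoissonKernel continuous_fst continuous_snd)
  have h3 := Continuous.poissonPow α continuous_fst continuous_snd
  rw [funext fun t => (hasDerivAt_sphericalMean k α t).deriv]
  refine hasDerivAt_intervalIntegral_of_continuous
    (F := fun t θ => -α * (invPoissonKernelDeriv t θ / invPoissonKernel t θ : ℝ) *
      poissonPow α t θ * ((Real.sin θ ^ (k - 1) : ℝ) : ℂ))
    (F' := fun t θ => (-α + (α + α ^ 2) *
      ((invPoissonKernelDeriv t θ / invPoissonKernel t θ : ℝ) : ℂ) ^ 2) *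
        poissonPow α t θ * ((Real.sin θ ^ (k - 1) : ℝ) : ℂ)) ?_ ?_ ?_ _ _ t
  · simp only [Function.uncurry_def]
    exact ((continuous_const.mul h2).mul h3).mul (by fun_prop)
  · simp only [Function.uncurry_def]
    exact ((continuous_const.add (continuous_const.mul (h2.pow 2))).mul h3).mul (by fun_prop)
  · exact fun t θ => (hasDerivAt_deriv_poissonPow α t θ).mul_const _

/-- The angular part of the Laplacian of `poissonPow`, in divergence form. -/
theorem hasDerivAt_angular_flux (n : ℕ) (α : ℂ) (t θ : ℝ) :
    HasDerivAt (fun θ => α * (Real.sinh t * Real.sin θ ^ (n + 1) / invPoissonKernel t θ : ℝ) *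
        poissonPow α t θ)
      ((α * (((n + 1) * Real.sinh t * Real.cos θ / invPoissonKernel t θ : ℝ) : ℂ) +
        (α + α ^ 2) * ((Real.sinh t * Real.sin θ / invPoissonKernel t θ : ℝ) : ℂ) ^ 2) *
        poissonPow α t θ * ((Real.sin θ ^ n : ℝ) : ℂ)) θ := by
  have h0 := (invPoissonKernel_pos t θ).ne'
  have h1 : HasDerivAt (fun θ => Real.sinh t * Real.sin θ ^ (n + 1) / invPoissonKernel t θ)
      ((Real.sinh t * ((n + 1) * Real.sin θ ^ n * Real.cos θ) * invPoissonKernel t θ -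
        Real.sinh t * Real.sin θ ^ (n + 1) * -(Real.sinh t * Real.sin θ)) /
          invPoissonKernel t θ ^ 2) θ := by
    simpa using (((Real.hasDerivAt_sin θ).fun_pow (n + 1)).const_mul (Real.sinh t)).fun_div
      (hasDerivAt_invPoissonKernel_angle t θ) h0
  refine ((h1.ofReal_comp.const_mul α).mul (hasDerivAt_poissonPow_angle α t θ)).congr_deriv ?_
  have h0' : (invPoissonKernel t θ : ℂ) ≠ 0 := by exact_mod_cast h0
  push_cast
  field_simp
  ring

/-- Divided by the right-hand side, this says that the logarithm of the Poisson kernel has gradient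
of length one for `dt² + sinh² t dθ²`. -/
theorem invPoissonKernelDeriv_sq_add (t θ : ℝ) :
    invPoissonKernelDeriv t θ ^ 2 + Real.sin θ ^ 2 = invPoissonKernel t θ ^ 2 := by
  rw [invPoissonKernelDeriv, invPoissonKernel, Real.sin_sq]
  linear_combination (1 - Real.cos θ ^ 2) * (-1) * Real.cosh_sq t

/-- The eigenvalue equation of `P^α` for `k = n + 1`, divided by `P^α`: radial part and eigenvalue
on the left, minus the angular part on the right. The latter is the divergence of
`hasDerivAt_angular_flux`, so it disappears on integration. -/
theorem poissonPow_eigen (n : ℕ) (α : ℂ) {t : ℝ} (ht : Real.sinh t ≠ 0) (θ : ℝ) :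
    (-α + (α + α ^ 2) * ((invPoissonKernelDeriv t θ / invPoissonKernel t θ : ℝ) : ℂ) ^ 2) +
      (((n + 1) * (Real.cosh t / Real.sinh t) : ℝ) : ℂ) *
        (-α * (invPoissonKernelDeriv t θ / invPoissonKernel t θ : ℝ)) +
      (α * (n + 1) - α ^ 2) =
    -(((Real.sinh t ^ 2)⁻¹ : ℝ) : ℂ) *
      (α * (((n + 1) * Real.sinh t * Real.cos θ / invPoissonKernel t θ : ℝ) : ℂ) +
        (α + α ^ 2) * ((Real.sinh t * Real.sin θ / invPoissonKernel t θ : ℝ) : ℂ) ^ 2) := by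
  have h0' : (invPoissonKernel t θ : ℂ) ≠ 0 := by exact_mod_cast (invPoissonKernel_pos t θ).ne'
  have ht' : (Real.sinh t : ℂ) ≠ 0 := by exact_mod_cast ht
  have e1 : (invPoissonKernelDeriv t θ : ℂ) ^ 2 + (Real.sin θ : ℂ) ^ 2 =
    (invPoissonKernel t θ : ℂ) ^ 2 := by exact_mod_cast invPoissonKernelDeriv_sq_add t θ
  have e2 : (Real.cosh t : ℂ) * invPoissonKernelDeriv t θ - Real.cos θ =
      Real.sinh t * invPoissonKernel t θ := by
    have : Real.cosh t * invPoissonKernelDeriv t θ - Real.cos θ =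
        Real.sinh t * invPoissonKernel t θ := by
      rw [invPoissonKernelDeriv, invPoissonKernel]
      linear_combination Real.cos θ * Real.cosh_sq t
    exact_mod_cast this
  simp only [Complex.ofReal_mul, Complex.ofReal_div, Complex.ofReal_inv, Complex.ofReal_pow,
    Complex.ofReal_add, Complex.ofReal_natCast, Complex.ofReal_one]
  generalize (Real.cosh t : ℂ) = c at *
  generalize (Real.sinh t : ℂ) = s at *
  generalize (Real.sin θ : ℂ) = σ at *
  generalize (Real.cos θ : ℂ) = γ at *
  generalize (invPoissonKernelDeriv t θ : ℂ) = Y at *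
  generalize (invPoissonKernel t θ : ℂ) = X at *
  field_simp
  linear_combination (α + α ^ 2) * s * e1 - α * (n + 1) * X * e2

/-- The flux carries the factor `sin^(n+1) θ`, which vanishes at both poles even when `n = 0`. -/
theorem integral_angular_flux (n : ℕ) (α : ℂ) (t : ℝ) :
    ∫ θ in (0 : ℝ)..Real.pi,
      (α * (((n + 1) * Real.sinh t * Real.cos θ / invPoissonKernel t θ : ℝ) : ℂ) +
        (α + α ^ 2) * ((Real.sinh t * Real.sin θ / invPoissonKernel t θ : ℝ) : ℂ) ^ 2) *
        poissonPow α t θ * ((Real.sin θ ^ n : ℝ) : ℂ) = 0 := by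
  have h3 : Continuous fun θ => poissonPow α t θ :=
    Continuous.poissonPow α continuous_const continuous_id
  have h4 : Continuous fun θ => (invPoissonKernel t θ)⁻¹ :=
    (Continuous.invPoissonKernel continuous_const continuous_id).inv₀
      fun θ => (invPoissonKernel_pos t θ).ne'
  rw [intervalIntegral.integral_eq_sub_of_hasDerivAt
    (fun θ _ => hasDerivAt_angular_flux n α t θ)]
  · simp
  · simp only [div_eq_mul_inv]
    exact Continuous.intervalIntegrable (by fun_prop) _ _

theorem polarLaplacian_sphericalMean (n : ℕ) (α : ℂ) {t : ℝ} (hs : Real.sinh t ≠ 0) :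
    polarLaplacian (n + 1) 1 (sphericalMean (n + 1) α) t +
      (α * (n + 1) - α ^ 2) * sphericalMean (n + 1) α t = 0 := by
  have h2 : Continuous fun θ => invPoissonKernelDeriv t θ / invPoissonKernel t θ :=
    Continuous.logDeriv_invPoissonKernel continuous_const continuous_id
  have h3 : Continuous fun θ => poissonPow α t θ :=
    Continuous.poissonPow α continuous_const continuous_id
  have hflux := integral_angular_flux n α t
  rw [polarLaplacian, (hasDerivAt_deriv_sphericalMean _ α t).deriv,
    (hasDerivAt_sphericalMean _ α t).deriv, sphericalMean]
  generalize hq : (fun θ => invPoissonKernelDeriv t θ / invPoissonKernel t θ) = q at h2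
  have hq' : ∀ θ, invPoissonKernelDeriv t θ / invPoissonKernel t θ = q θ := fun θ => by rw [← hq]
  have hE := fun θ => poissonPow_eigen n α hs θ
  simp only [hq'] at hE ⊢
  rw [← intervalIntegral.integral_const_mul, ← intervalIntegral.integral_const_mul,
    ← intervalIntegral.integral_add, ← intervalIntegral.integral_add]
  · rw [← mul_zero (-(((Real.sinh t ^ 2)⁻¹ : ℝ) : ℂ)), ← hflux,
      ← intervalIntegral.integral_const_mul]
    refine intervalIntegral.integral_congr fun θ _ => ?_
    simp only [div_one, Nat.add_sub_cancel, Nat.cast_add, Nat.cast_one]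
    linear_combination (poissonPow α t θ * ((Real.sin θ ^ n : ℝ) : ℂ)) * hE θ
  all_goals exact Continuous.intervalIntegrable (by fun_prop) _ _

theorem isPolarEigenfunction_sphericalMean {k : ℕ} (hk : 1 ≤ k) (α : ℂ) :
    IsPolarEigenfunction k 1 (α * k - α ^ 2) (sphericalMean k α) where
  continuousWithinAt_zero := (hasDerivAt_sphericalMean k α 0).continuousAt.continuousWithinAt
  differentiableOn := fun t _ =>
    (hasDerivAt_sphericalMean k α t).differentiableAt.differentiableWithinAt
  differentiableOn_deriv := fun t _ =>
    (hasDerivAt_deriv_sphericalMean k α t).differentiableAt.differentiableWithinAt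
  eigen := by
    intro t ht
    obtain ⟨n, rfl⟩ := Nat.exists_eq_add_of_le' hk
    have hs := (Real.sinh_pos_iff.2 ht).ne'
    exact_mod_cast polarLaplacian_sphericalMean n α hs

end

/-! ### Uniqueness of polar eigenfunctions -/

section

open Filter Topology

theorem IsPolarEigenfunction.hasDerivAt {k : ℕ} {ρ : ℝ} {μ : ℂ} {φ : ℝ → ℂ}
    (h : IsPolarEigenfunction k ρ μ φ) {r : ℝ} (hr : 0 < r) : HasDerivAt φ (deriv φ r) r :=
  ((h.differentiableOn r hr).differentiableAt (Ioi_mem_nhds hr)).hasDerivAt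

theorem IsPolarEigenfunction.hasDerivAt_deriv {k : ℕ} {ρ : ℝ} {μ : ℂ} {φ : ℝ → ℂ}
    (h : IsPolarEigenfunction k ρ μ φ) {r : ℝ} (hr : 0 < r) :
    HasDerivAt (deriv φ) (-(((k / ρ * (Real.cosh (r / ρ) / Real.sinh (r / ρ)) : ℝ) : ℂ) *
      deriv φ r + μ * φ r)) r := by
  refine (((h.differentiableOn_deriv r hr).differentiableAt
    (Ioi_mem_nhds hr)).hasDerivAt).congr_deriv ?_
  have := h.eigen r hr
  rw [polarLaplacian] at this
  linear_combination this

/-- The radial equation in divergence form. -/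
theorem IsPolarEigenfunction.hasDerivAt_flux {k : ℕ} {μ : ℂ} {φ : ℝ → ℂ}
    (h : IsPolarEigenfunction k 1 μ φ) {r : ℝ} (hr : 0 < r) :
    HasDerivAt (fun r => ((Real.sinh r ^ k : ℝ) : ℂ) * deriv φ r)
      (-(μ * ((Real.sinh r ^ k : ℝ) : ℂ) * φ r)) r := by
  have hs : (Real.sinh r : ℂ) ≠ 0 := by exact_mod_cast (Real.sinh_pos_iff.2 hr).ne'
  refine (((Real.hasDerivAt_sinh r).fun_pow k).ofReal_comp.mul (h.hasDerivAt_deriv hr)).congr_deriv ?_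
  rcases k with _ | n
  · simp
  · simp only [div_one, Nat.add_sub_cancel]
    push_cast at hs ⊢
    field_simp
    ring

/-- A function bounded near `0` cannot have a derivative bounded below by a multiple of `coth`. -/
theorem not_bounded_of_coth_le_deriv {g g' : ℝ → ℝ} {r η B : ℝ} (hr : 0 < r) (hη : 0 < η)
    (hg : ∀ s ∈ Set.Ioc 0 r, HasDerivAt g (g' s) s)
    (hg' : ∀ s ∈ Set.Ioc 0 r, η * (Real.cosh s / Real.sinh s) ≤ g' s)
    (hB : ∀ s ∈ Set.Ioc 0 r, -B ≤ g s) : False := by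
  -- Since `coth = (log sinh)'`, this difference is nondecreasing, which forces `g` to `-∞` along
  -- with `η log sinh s` as `s → 0`.
  have hd : ∀ s ∈ Set.Ioc 0 r, HasDerivAt (fun s => g s - η * Real.log (Real.sinh s))
      (g' s - η * (Real.cosh s / Real.sinh s)) s := fun s hs =>
    (hg s hs).sub (((Real.hasDerivAt_sinh s).log (Real.sinh_pos_iff.2 hs.1).ne').const_mul η)
  have hmono : MonotoneOn (fun s => g s - η * Real.log (Real.sinh s)) (Set.Ioc 0 r) := by
    refine monotoneOn_of_deriv_nonneg (convex_Ioc 0 r)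
      (fun s hs => (hd s hs).continuousAt.continuousWithinAt) ?_ ?_
    · intro s hs
      exact (hd s (interior_subset hs)).differentiableAt.differentiableWithinAt
    · intro s hs
      rw [(hd s (interior_subset hs)).deriv]
      linarith [hg' s (interior_subset hs)]
  have hlim : Tendsto (fun s => Real.log (Real.sinh s)) (𝓝[>] 0) atBot := by
    refine Real.tendsto_log_nhdsGT_zero.comp (tendsto_nhdsWithin_iff.2 ⟨?_, ?_⟩)
    · simpa using (Real.continuous_sinh.tendsto 0).mono_left nhdsWithin_le_nhds
    · filter_upwards [self_mem_nhdsWithin] with s hs using Real.sinh_pos_iff.2 hs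
  obtain ⟨s, hs1, hs2⟩ := ((hlim.eventually_lt_atBot
    ((-B - (g r - η * Real.log (Real.sinh r))) / η)).and (Ioc_mem_nhdsGT hr)).exists
  have h1 := hmono hs2 ⟨hr, le_rfl⟩ hs2.2
  rw [lt_div_iff₀ hη] at hs1
  have h2 := hB s hs2
  simp only at h1
  linarith

/-- The flux `q = sinh^k · φ'` has derivative `-μ sinh^k φ`, so on `(0, r]` it differs from `q r` by
at most `sinh^k r · ‖μ‖ M r`. Were the bound false, the component of `q` along `q r` would stay
above a positive constant. Then `φ'` would grow at least like `1/sinh^k s` in that direction, and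
since `k ≥ 1` this contradicts the boundedness of `φ`. -/
theorem IsPolarEigenfunction.norm_deriv_le {k : ℕ} (hk : 1 ≤ k) {μ : ℂ} {φ : ℝ → ℂ}
    (h : IsPolarEigenfunction k 1 μ φ) {r M : ℝ} (hr : 0 < r)
    (hM : ∀ s ∈ Set.Ioc 0 r, ‖φ s‖ ≤ M) : ‖deriv φ r‖ ≤ ‖μ‖ * M * r := by
  by_contra! hlt
  obtain ⟨n, rfl⟩ := Nat.exists_eq_add_of_le' hk
  have hM0 : 0 ≤ M := (norm_nonneg _).trans (hM r ⟨hr, le_rfl⟩)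
  set S := Real.sinh r ^ (n + 1) with hS
  have hS0 : 0 < S := pow_pos (Real.sinh_pos_iff.2 hr) _
  set q : ℝ → ℂ := fun r => ((Real.sinh r ^ (n + 1) : ℝ) : ℂ) * deriv φ r with hq
  have hqr : ‖q r‖ = S * ‖deriv φ r‖ := by
    rw [hq]; simp only [norm_mul, Complex.norm_real, Real.norm_eq_abs, abs_of_pos hS0, ← hS]
  have hsh : ∀ s ∈ Set.Ioc 0 r, 0 < Real.sinh s ∧ Real.sinh s ≤ Real.sinh r := fun s hs =>
    ⟨Real.sinh_pos_iff.2 hs.1, Real.sinh_le_sinh.2 hs.2⟩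
  have hdist : ∀ s ∈ Set.Ioc 0 r, ‖q r - q s‖ ≤ S * (‖μ‖ * M * r) := by
    intro s hs
    have h1 := (convex_Ioc 0 r).norm_image_sub_le_of_norm_hasDerivWithin_le (f := q)
      (C := ‖μ‖ * S * M) (x := s) (y := r)
      (fun x hx => (h.hasDerivAt_flux hx.1).hasDerivWithinAt) ?_ hs ⟨hr, le_rfl⟩
    · refine h1.trans ?_
      rw [Real.norm_eq_abs, abs_of_nonneg (by linarith [hs.2])]
      have : ‖μ‖ * S * M * (r - s) ≤ ‖μ‖ * S * M * r :=
        mul_le_mul_of_nonneg_left (by linarith [hs.1]) (by positivity)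
      linarith
    · intro x hx
      have hx' := hsh x hx
      rw [norm_neg, norm_mul, norm_mul, Complex.norm_real, Real.norm_eq_abs,
        abs_of_nonneg (pow_nonneg hx'.1.le _)]
      have h3 : Real.sinh x ^ (n + 1) ≤ S := pow_le_pow_left₀ hx'.1.le hx'.2 _
      have h4 := hM x hx
      gcongr
  have hqpos : 0 < ‖q r‖ := by
    rw [hqr]; exact mul_pos hS0 (lt_of_le_of_lt (by positivity) hlt)
  set δ := ‖q r‖ * (S * ‖deriv φ r‖ - S * (‖μ‖ * M * r)) with hδ
  have hδ0 : 0 < δ := mul_pos hqpos (sub_pos.2 (mul_lt_mul_of_pos_left hlt hS0))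
  have hin : ∀ s ∈ Set.Ioc 0 r, δ ≤ inner ℝ (q r) (q s) := by
    intro s hs
    have e : inner ℝ (q r) (q s) = ‖q r‖ ^ 2 - inner ℝ (q r) (q r - q s) := by
      rw [inner_sub_right, real_inner_self_eq_norm_sq]; ring
    have h1 := (real_inner_le_norm (q r) (q r - q s)).trans
      (mul_le_mul_of_nonneg_left (hdist s hs) (norm_nonneg _))
    rw [e, hδ, ← hqr]
    linarith
  -- On `(0, r]`, `sinh^n · cosh ≤ K`, so `δ / sinh^(n+1)` dominates `(δ/K) coth`.
  set K := Real.sinh r ^ n * Real.cosh r with hK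
  have hK0 : 0 < K := mul_pos (pow_pos (Real.sinh_pos_iff.2 hr) _) (Real.cosh_pos _)
  refine not_bounded_of_coth_le_deriv (g := fun s => inner ℝ (q r) (φ s))
    (g' := fun s => inner ℝ (q r) (deriv φ s)) (η := δ / K) (B := ‖q r‖ * M) hr
    (div_pos hδ0 hK0) ?_ ?_ ?_
  · intro s hs
    simpa using (hasDerivAt_const s (q r)).inner ℝ (h.hasDerivAt hs.1)
  · intro s hs
    obtain ⟨h0, h1⟩ := hsh s hs
    have hi : inner ℝ (q r) (q s) = Real.sinh s ^ (n + 1) * inner ℝ (q r) (deriv φ s) := by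
      rw [← real_inner_smul_right, Complex.real_smul]
    have h2 := hin s hs
    rw [hi] at h2
    have h3 : Real.sinh s ^ n * Real.cosh s ≤ K :=
      mul_le_mul (pow_le_pow_left₀ h0.le h1 _)
        (Real.cosh_le_cosh.2 (by rw [abs_of_pos hs.1, abs_of_pos hr]; exact hs.2))
        (Real.cosh_pos _).le (pow_pos (Real.sinh_pos_iff.2 hr) _).le
    rw [div_mul_div_comm, div_le_iff₀ (mul_pos hK0 h0)]
    have hi0 : 0 ≤ inner ℝ (q r) (deriv φ s) :=
      nonneg_of_mul_nonneg_right (hδ0.le.trans h2) (pow_pos h0 _)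
    calc δ * Real.cosh s
        ≤ (Real.sinh s ^ (n + 1) * inner ℝ (q r) (deriv φ s)) * Real.cosh s :=
          mul_le_mul_of_nonneg_right h2 (Real.cosh_pos _).le
      _ = (inner ℝ (q r) (deriv φ s) * Real.sinh s) * (Real.sinh s ^ n * Real.cosh s) := by ring
      _ ≤ (inner ℝ (q r) (deriv φ s) * Real.sinh s) * K :=
          mul_le_mul_of_nonneg_left h3 (mul_nonneg hi0 h0.le)
      _ = inner ℝ (q r) (deriv φ s) * (K * Real.sinh s) := by ring
  · intro s hs
    have h1 := (abs_le.1 (abs_real_inner_le_norm (q r) (φ s))).1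
    have h2 := mul_le_mul_of_nonneg_left (hM s hs) (norm_nonneg (q r))
    linarith

theorem IsPolarEigenfunction.tendsto_deriv {k : ℕ} (hk : 1 ≤ k) {μ : ℂ} {φ : ℝ → ℂ}
    (h : IsPolarEigenfunction k 1 μ φ) : Tendsto (deriv φ) (𝓝[>] 0) (𝓝 0) := by
  have hb : ∀ᶠ s in 𝓝[≥] (0 : ℝ), ‖φ s‖ < ‖φ 0‖ + 1 :=
    h.continuousWithinAt_zero.norm.eventually_lt_const (by linarith)
  obtain ⟨δ, hδ, hδM⟩ := mem_nhdsGE_iff_exists_Icc_subset.1 hb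
  refine squeeze_zero_norm' (a := fun r => ‖μ‖ * (‖φ 0‖ + 1) * r) ?_ ?_
  · filter_upwards [Ioc_mem_nhdsGT hδ] with r hr
    exact h.norm_deriv_le hk hr.1 fun s hs => (hδM ⟨hs.1.le, hs.2.trans hr.2⟩).le
  · have : Tendsto (fun r : ℝ => ‖μ‖ * (‖φ 0‖ + 1) * r) (𝓝 0) (𝓝 (‖μ‖ * (‖φ 0‖ + 1) * 0)) :=
      (continuous_const.mul continuous_id).tendsto 0
    rw [mul_zero] at this
    exact this.mono_left nhdsWithin_le_nhds

/-- A polar eigenfunction that vanishes at the origin vanishes identically. -/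
theorem IsPolarEigenfunction.eq_zero {k : ℕ} (hk : 1 ≤ k) {μ : ℂ} {φ : ℝ → ℂ}
    (h : IsPolarEigenfunction k 1 μ φ) (h0 : φ 0 = 0) {r : ℝ} (hr : 0 < r) : φ r = 0 := by
  -- The `coth` term only decreases the energy `‖φ‖² + ‖φ'‖²`. The other terms are at most `2 (1 +
  -- ‖μ‖) ‖φ‖ ‖φ'‖`, hence at most `C` times the energy, so the damped energy `F` is nonincreasing.
  set C := 1 + ‖μ‖ with hC
  set F : ℝ → ℝ := fun s => (‖φ s‖ ^ 2 + ‖deriv φ s‖ ^ 2) * Real.exp (-(C * s)) with hF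
  have hd : ∀ s, 0 < s → ∃ F', HasDerivAt F F' s ∧ F' ≤ 0 := by
    intro s hs
    have h1 := ((h.hasDerivAt hs).norm_sq.add (h.hasDerivAt_deriv hs).norm_sq).mul
      (((hasDerivAt_id s).const_mul C).neg.exp)
    refine ⟨_, h1, ?_⟩
    set c : ℝ := (k : ℝ) / 1 * (Real.cosh (s / 1) / Real.sinh (s / 1)) with hc
    have hc0 : 0 ≤ c := by
      have := Real.sinh_pos_iff.2 hs
      have := Real.cosh_pos s
      rw [hc]; simp only [div_one]; positivity
    have e1 : inner ℝ (deriv φ s) (-((c : ℂ) * deriv φ s + μ * φ s)) =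
        -(c * ‖deriv φ s‖ ^ 2) - inner ℝ (deriv φ s) (μ * φ s) := by
      rw [inner_neg_right, inner_add_right, ← Complex.real_smul, real_inner_smul_right,
        real_inner_self_eq_norm_sq]
      ring
    have e2 := real_inner_le_norm (φ s) (deriv φ s)
    have e3 := (abs_le.1 (abs_real_inner_le_norm (deriv φ s) (μ * φ s))).1
    rw [norm_mul] at e3
    have e4 : 2 * (‖φ s‖ * ‖deriv φ s‖) ≤ ‖φ s‖ ^ 2 + ‖deriv φ s‖ ^ 2 := by
      nlinarith [sq_nonneg (‖φ s‖ - ‖deriv φ s‖)]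
    have e5 := mul_le_mul_of_nonneg_left e4 (by positivity : (0 : ℝ) ≤ C)
    have e6 : 0 ≤ c * ‖deriv φ s‖ ^ 2 := by positivity
    have hexp := Real.exp_pos (-(C * s))
    rw [e1]
    simp only [id, Pi.add_apply, Pi.neg_apply, mul_one]
    have key : 2 * inner ℝ (φ s) (deriv φ s) +
        2 * (-(c * ‖deriv φ s‖ ^ 2) - inner ℝ (deriv φ s) (μ * φ s)) ≤
        C * (‖φ s‖ ^ 2 + ‖deriv φ s‖ ^ 2) := by
      rw [hC] at e5 ⊢
      linarith
    have := mul_le_mul_of_nonneg_right key hexp.le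
    linarith
  have hanti : AntitoneOn F (Set.Ioi 0) := by
    refine antitoneOn_of_deriv_nonpos (convex_Ioi 0) ?_ ?_ ?_
    · intro s hs
      obtain ⟨_, h1, _⟩ := hd s hs
      exact h1.continuousAt.continuousWithinAt
    · intro s hs
      obtain ⟨_, h1, _⟩ := hd s (interior_subset hs)
      exact h1.differentiableAt.differentiableWithinAt
    · intro s hs
      obtain ⟨_, h1, h2⟩ := hd s (interior_subset hs)
      rwa [h1.deriv]
  have hlim : Tendsto F (𝓝[>] 0) (𝓝 0) := by
    have h1 : Tendsto φ (𝓝[>] 0) (𝓝 0) := by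
      have := h.continuousWithinAt_zero.mono Set.Ioi_subset_Ici_self
      rwa [ContinuousWithinAt, h0] at this
    have h2 := h.tendsto_deriv hk
    have h3 : Tendsto (fun s => Real.exp (-(C * s))) (𝓝[>] 0) (𝓝 (Real.exp (-(C * 0)))) :=
      (Continuous.tendsto (by fun_prop) 0).mono_left nhdsWithin_le_nhds
    simpa using ((h1.norm.pow 2).add (h2.norm.pow 2)).mul h3
  have hle : F r ≤ 0 := by
    refine ge_of_tendsto hlim ?_
    filter_upwards [Ioc_mem_nhdsGT hr] with s hs
    exact hanti hs.1 hr hs.2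
  have h1 : ‖φ r‖ ^ 2 + ‖deriv φ r‖ ^ 2 ≤ 0 :=
    nonpos_of_mul_nonpos_left hle (Real.exp_pos _)
  have h2 : ‖φ r‖ ^ 2 = 0 := le_antisymm (by nlinarith [sq_nonneg ‖deriv φ r‖]) (sq_nonneg _)
  simpa using h2

theorem IsPolarEigenfunction.const_mul_sub {k : ℕ} {ρ : ℝ} {μ : ℂ} {φ ψ : ℝ → ℂ}
    (hφ : IsPolarEigenfunction k ρ μ φ) (hψ : IsPolarEigenfunction k ρ μ ψ) (c : ℂ) :
    IsPolarEigenfunction k ρ μ (fun r => c * φ r - ψ r) := by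
  have h1 : ∀ r, 0 < r → HasDerivAt (fun r => c * φ r - ψ r) (c * deriv φ r - deriv ψ r) r :=
    fun r hr => ((hφ.hasDerivAt hr).const_mul c).sub (hψ.hasDerivAt hr)
  have h2 : ∀ r, 0 < r → deriv (fun r => c * φ r - ψ r) =ᶠ[𝓝 r]
      fun r => c * deriv φ r - deriv ψ r := fun r hr => by
    filter_upwards [Ioi_mem_nhds hr] with s hs using (h1 s hs).deriv
  have h3 := fun r hr => (((hφ.hasDerivAt_deriv hr).const_mul c).sub
    (hψ.hasDerivAt_deriv hr)).congr_of_eventuallyEq (h2 r hr)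
  refine ⟨(continuousWithinAt_const.mul hφ.continuousWithinAt_zero).sub hψ.continuousWithinAt_zero,
    fun r hr => (h1 r hr).differentiableAt.differentiableWithinAt,
    fun r hr => (h3 r hr).differentiableAt.differentiableWithinAt, fun r hr => ?_⟩
  rw [polarLaplacian, (h3 r hr).deriv, (h1 r hr).deriv]
  ring

/-- Polar eigenfunctions with the same eigenvalue are proportional to their values at `0`. -/
theorem IsPolarEigenfunction.mul_eq {k : ℕ} (hk : 1 ≤ k) {μ : ℂ} {φ ψ : ℝ → ℂ}
    (hφ : IsPolarEigenfunction k 1 μ φ) (hψ : IsPolarEigenfunction k 1 μ ψ) (h0 : φ 0 = 1)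
    {r : ℝ} (hr : 0 < r) : ψ 0 * φ r = ψ r :=
  sub_eq_zero.1 ((hφ.const_mul_sub hψ (ψ 0)).eq_zero hk (by simp [h0]) hr)

/-- Rescaling to curvature `-1`. -/
theorem IsPolarEigenfunction.rescale {k : ℕ} {ρ : ℝ} (hρ : 0 < ρ) {μ : ℂ} {φ : ℝ → ℂ}
    (h : IsPolarEigenfunction k ρ μ φ) :
    IsPolarEigenfunction k 1 (ρ ^ 2 * μ) (fun t => φ (ρ * t)) := by
  have hlin : ∀ t : ℝ, HasDerivAt (fun t => ρ * t) ρ t := fun t => by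
    simpa using (hasDerivAt_id t).const_mul ρ
  have h1 : ∀ t, 0 < t → HasDerivAt (fun t => φ (ρ * t)) (ρ * deriv φ (ρ * t)) t := fun t ht =>
    ((h.hasDerivAt (mul_pos hρ ht)).scomp t (hlin t)).congr_deriv (Complex.real_smul ..)
  have h2 : ∀ t, 0 < t → deriv (fun t => φ (ρ * t)) =ᶠ[𝓝 t]
      fun t => ρ * deriv φ (ρ * t) := fun t ht => by
    filter_upwards [Ioi_mem_nhds ht] with s hs using (h1 s hs).deriv
  have h3 := fun t ht => (((h.hasDerivAt_deriv (mul_pos hρ ht)).scomp t (hlin t)).const_mul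
    (ρ : ℂ)).congr_of_eventuallyEq (h2 t ht)
  refine ⟨?_, fun r hr => (h1 r hr).differentiableAt.differentiableWithinAt,
    fun r hr => (h3 r hr).differentiableAt.differentiableWithinAt, fun t ht => ?_⟩
  · refine ContinuousWithinAt.comp (t := Set.Ici 0) (by simpa using h.continuousWithinAt_zero)
      (hlin 0).continuousAt.continuousWithinAt fun t ht => ?_
    exact mul_nonneg hρ.le ht
  · have hρ' : (ρ : ℂ) ≠ 0 := by exact_mod_cast hρ.ne'
    rw [polarLaplacian, (h3 t ht).deriv, (h1 t ht).deriv, Complex.real_smul,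
      mul_div_cancel_left₀ _ hρ.ne', div_one, div_one]
    push_cast
    field_simp
    ring

end

/-! ### The ball model in polar coordinates -/

section

open Filter Topology

/-! ### Gradient and divergence of radial expressions in Euclidean space. -/

section Radial

variable {k : ℕ}

theorem hasFDerivAt_norm_of_ne_zero {x : EuclideanSpace ℝ (Fin (k + 1))} (hx : x ≠ 0) :
    HasFDerivAt (fun y : EuclideanSpace ℝ (Fin (k + 1)) => ‖y‖) (‖x‖⁻¹ • innerSL ℝ x) x := by
  have h := (hasStrictFDerivAt_norm_sq x).hasFDerivAt.sqrt (by simpa using hx)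
  simp only [Real.sqrt_sq (norm_nonneg _)] at h
  refine h.congr_fderiv ?_
  ext v
  simp
  ring

theorem hasFDerivAt_radial {g : ℝ → ℂ} {g' : ℂ} {x : EuclideanSpace ℝ (Fin (k + 1))} (hx : x ≠ 0)
    (hg : HasDerivAt g g' ‖x‖) :
    HasFDerivAt (fun y : EuclideanSpace ℝ (Fin (k + 1)) => g ‖y‖)
      ((ContinuousLinearMap.toSpanSingleton ℝ g').comp (‖x‖⁻¹ • innerSL ℝ x)) x :=
  hg.hasFDerivAt.comp x (hasFDerivAt_norm_of_ne_zero hx)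

theorem partialDeriv_radial {g : ℝ → ℂ} {g' : ℂ} {x : EuclideanSpace ℝ (Fin (k + 1))} (hx : x ≠ 0)
    (hg : HasDerivAt g g' ‖x‖) (i : Fin (k + 1)) :
    partialDeriv i (fun y => g ‖y‖) x = ((x i / ‖x‖ : ℝ) : ℂ) * g' := by
  rw [partialDeriv, (hasFDerivAt_radial hx hg).fderiv]
  simp [EuclideanSpace.inner_single_right, div_eq_inv_mul, mul_assoc]

theorem sum_partialDeriv_coord_mul_radial {G : ℝ → ℂ} {G' : ℂ}
    {x : EuclideanSpace ℝ (Fin (k + 1))} (hx : x ≠ 0) (hG : HasDerivAt G G' ‖x‖) :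
    ∑ i, partialDeriv i (fun y => ((y i : ℝ) : ℂ) * G ‖y‖) x = ‖x‖ * G' + (k + 1) * G ‖x‖ := by
  have hx' : (‖x‖ : ℂ) ≠ 0 := by simpa using hx
  have h1 : ∀ i, partialDeriv i (fun y => ((y i : ℝ) : ℂ) * G ‖y‖) x =
      ((x i ^ 2 : ℝ) : ℂ) * (G' / ‖x‖) + G ‖x‖ := by
    intro i
    have hc : HasFDerivAt (fun y : EuclideanSpace ℝ (Fin (k + 1)) => ((y i : ℝ) : ℂ))
        (Complex.ofRealCLM.comp (EuclideanSpace.proj i)) x :=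
      (Complex.ofRealCLM.comp (EuclideanSpace.proj i)).hasFDerivAt
    rw [partialDeriv, (hc.fun_mul (hasFDerivAt_radial hx hG)).fderiv]
    simp [EuclideanSpace.inner_single_right]
    field_simp
  rw [Finset.sum_congr rfl fun i _ => h1 i, Finset.sum_add_distrib, ← Finset.sum_mul,
    ← Complex.ofReal_sum, ← EuclideanSpace.real_norm_sq_eq]
  simp
  field_simp

end Radial

/-! ### Hyperbolic radius against Euclidean norm. -/

section BallModel

variable {ρ : ℝ}

theorem hasDerivAt_radius {t : ℝ} (ht : 0 < t) (htρ : t < ρ) :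
    HasDerivAt (fun t => ρ * Real.log ((ρ + t) / (ρ - t))) (2 * ρ ^ 2 / (ρ ^ 2 - t ^ 2)) t := by
  have h1 : ρ - t ≠ 0 := by linarith
  have h2 : ρ + t ≠ 0 := by linarith
  have h3 : ρ ^ 2 - t ^ 2 ≠ 0 := by
    rw [sq_sub_sq]; exact mul_ne_zero h2 h1
  refine (((((hasDerivAt_id t).const_add ρ).fun_div ((hasDerivAt_id t).const_sub ρ) h1).log
    (div_ne_zero h2 h1)).const_mul ρ).congr_deriv ?_
  simp only [id]
  field_simp
  ring

theorem hasDerivAt_conformal_pow_div (k : ℕ) {t : ℝ} (ht : 0 < t) (htρ : t < ρ) :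
    HasDerivAt (fun t => (2 * ρ ^ 2 / (ρ ^ 2 - t ^ 2)) ^ k / t)
      (k * (2 * ρ ^ 2 / (ρ ^ 2 - t ^ 2)) ^ (k + 1) / ρ ^ 2 -
        (2 * ρ ^ 2 / (ρ ^ 2 - t ^ 2)) ^ k / t ^ 2) t := by
  have hρ : ρ ≠ 0 := by linarith
  have h3 : ρ ^ 2 - t ^ 2 ≠ 0 := by
    rw [sq_sub_sq]; exact mul_ne_zero (by linarith) (by linarith)
  have hc : HasDerivAt (fun t => 2 * ρ ^ 2 / (ρ ^ 2 - t ^ 2))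
      ((2 * ρ ^ 2 / (ρ ^ 2 - t ^ 2)) ^ 2 * t / ρ ^ 2) t := by
    refine ((hasDerivAt_const t (2 * ρ ^ 2)).fun_div (((hasDerivAt_id t).fun_pow 2).const_sub
      (ρ ^ 2)) h3).congr_deriv ?_
    simp only [id]
    field_simp
    ring
  refine ((hc.fun_pow k).fun_div (hasDerivAt_id t) ht.ne').congr_deriv ?_
  generalize 2 * ρ ^ 2 / (ρ ^ 2 - t ^ 2) = c
  simp only [id]
  rcases k with _ | n
  · simp [neg_div]
  · simp only [Nat.add_sub_cancel]
    field_simp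
    ring

/-- The Euclidean norm of the points at hyperbolic distance `r` from the origin. -/
noncomputable def ballRadius (ρ r : ℝ) : ℝ :=
  ρ * (Real.sinh (r / (2 * ρ)) / Real.cosh (r / (2 * ρ)))

theorem radius_ballRadius (hρ : 0 < ρ) (r : ℝ) :
    ρ * Real.log ((ρ + ballRadius ρ r) / (ρ - ballRadius ρ r)) = r := by
  set x := r / (2 * ρ) with hx
  have hC := Real.cosh_pos x
  have h1 : (ρ + ballRadius ρ r) / (ρ - ballRadius ρ r) = Real.exp (2 * x) := by
    have e1 := Real.cosh_add_sinh x
    have e2 := Real.cosh_sub_sinh x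
    have e3 : Real.exp (2 * x) * Real.exp (-x) = Real.exp x := by rw [← Real.exp_add]; ring_nf
    have e4 : ρ - ballRadius ρ r = ρ / Real.cosh x * Real.exp (-x) := by
      rw [ballRadius, ← hx, ← e2]; field_simp
    have e5 : ρ + ballRadius ρ r = ρ / Real.cosh x * Real.exp x := by
      rw [ballRadius, ← hx, ← e1]; field_simp
    rw [e4, e5, ← e3]
    have := Real.exp_pos (-x)
    field_simp
  rw [h1, Real.log_exp, hx]
  field_simp

theorem abs_ballRadius_lt (hρ : 0 < ρ) (r : ℝ) : |ballRadius ρ r| < ρ := by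
  have hC := Real.cosh_pos (r / (2 * ρ))
  rw [ballRadius, abs_mul, abs_of_pos hρ, abs_div, abs_of_pos hC]
  have : |Real.sinh (r / (2 * ρ))| < Real.cosh (r / (2 * ρ)) :=
    abs_lt_of_sq_lt_sq (by linarith [Real.cosh_sq (r / (2 * ρ))]) hC.le
  calc ρ * _ < ρ * 1 := mul_lt_mul_of_pos_left ((div_lt_one hC).2 this) hρ
    _ = ρ := mul_one ρ

theorem ballRadius_nonneg (hρ : 0 < ρ) {r : ℝ} (hr : 0 ≤ r) : 0 ≤ ballRadius ρ r :=
  mul_nonneg hρ.le (div_nonneg (Real.sinh_nonneg_iff.2 (by positivity)) (Real.cosh_pos _).le)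

theorem ballRadius_pos (hρ : 0 < ρ) {r : ℝ} (hr : 0 < r) : 0 < ballRadius ρ r :=
  mul_pos hρ (div_pos (Real.sinh_pos_iff.2 (by positivity)) (Real.cosh_pos _))

theorem contDiff_ballRadius (ρ : ℝ) {n : WithTop ℕ∞} : ContDiff ℝ n (ballRadius ρ) := by
  unfold ballRadius
  refine contDiff_const.mul (ContDiff.div ?_ ?_ fun r => (Real.cosh_pos _).ne')
  · exact Real.contDiff_sinh.comp (contDiff_id.div_const _)
  · exact Real.contDiff_cosh.comp (contDiff_id.div_const _)

/-- The mean curvature of the geodesic sphere of radius `r` in the ball model. -/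
theorem ballRadius_coth (hρ : 0 < ρ) {r : ℝ} (hr : 0 < r) :
    ballRadius ρ r / ρ ^ 2 +
      (ballRadius ρ r * (2 * ρ ^ 2 / (ρ ^ 2 - ballRadius ρ r ^ 2)))⁻¹ =
    1 / ρ * (Real.cosh (r / ρ) / Real.sinh (r / ρ)) := by
  have hx : r / ρ = 2 * (r / (2 * ρ)) := by field_simp
  rw [hx, Real.cosh_two_mul, Real.sinh_two_mul, ballRadius]
  have hC := Real.cosh_pos (r / (2 * ρ))
  have hS : 0 < Real.sinh (r / (2 * ρ)) := Real.sinh_pos_iff.2 (by positivity)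
  have hsq := Real.cosh_sq (r / (2 * ρ))
  generalize Real.cosh (r / (2 * ρ)) = C at *
  generalize Real.sinh (r / (2 * ρ)) = S at *
  have e : ρ ^ 2 - (ρ * (S / C)) ^ 2 = ρ ^ 2 / C ^ 2 := by
    field_simp
    linarith
  rw [e]
  field_simp
  linarith

end BallModel

/-- Because `dr/d|x|` is the conformal factor `c`, the weighted gradient `c^(k-1) ∇f` is the field
`x G(|x|)` with `G = c^k φ'/|x|`. Its divergence divided by `c^(k+1)` is `φ'' + k (t/ρ² + 1/(tc))
φ'`, and `ballRadius_coth` evaluates the coefficient. -/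
theorem hyperbolicLaplacian_radial {k : ℕ} {ρ : ℝ} (hρ : 0 < ρ) {φ φ' : ℝ → ℂ} {φ'' : ℂ} {r : ℝ}
    (hr : 0 < r) (h1 : ∀ s, 0 < s → HasDerivAt φ (φ' s) s) (h2 : HasDerivAt φ' φ'' r)
    {m : EuclideanSpace ℝ (Fin (k + 1))} (hm : ‖m‖ = ballRadius ρ r) :
    hyperbolicLaplacian ρ (fun x => φ (hyperbolicRadius ρ x)) m =
      φ'' + ((k / ρ * (Real.cosh (r / ρ) / Real.sinh (r / ρ)) : ℝ) : ℂ) * φ' r := by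
  set t := ballRadius ρ r with ht
  have ht0 : 0 < t := ballRadius_pos hρ hr
  have htρ : t < ρ := (le_abs_self _).trans_lt (abs_ballRadius_lt hρ r)
  have hRt : ρ * Real.log ((ρ + t) / (ρ - t)) = r := radius_ballRadius hρ r
  have hm0 : m ≠ 0 := by rw [← norm_pos_iff, hm]; exact ht0
  set c := 2 * ρ ^ 2 / (ρ ^ 2 - t ^ 2) with hc
  have hcpos : 0 < c := by
    have : 0 < ρ ^ 2 - t ^ 2 := by rw [sq_sub_sq]; exact mul_pos (by linarith) (by linarith)
    positivity
  set G : ℝ → ℂ := fun s => (((2 * ρ ^ 2 / (ρ ^ 2 - s ^ 2)) ^ k / s : ℝ) : ℂ) *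
    φ' (ρ * Real.log ((ρ + s) / (ρ - s))) with hG
  have hGd : HasDerivAt G (((k * c ^ (k + 1) / ρ ^ 2 - c ^ k / t ^ 2 : ℝ) : ℂ) * φ' r +
      ((c ^ k / t : ℝ) : ℂ) * ((c : ℂ) * φ'')) t := by
    have e := (hasDerivAt_conformal_pow_div k ht0 htρ).ofReal_comp.fun_mul
      (HasDerivAt.scomp t (by rwa [hRt]) (hasDerivAt_radius ht0 htρ) (g₁ := φ'))
    refine e.congr_deriv ?_
    simp only [hRt, Function.comp_apply, Complex.real_smul, hc]
  have hev : ∀ i, (fun x => ((conformalFactor ρ x ^ (k + 1) * (conformalFactor ρ x ^ 2)⁻¹ : ℝ) : ℂ)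
        * partialDeriv i (fun x => φ (hyperbolicRadius ρ x)) x) =ᶠ[𝓝 m]
      fun x => ((x i : ℝ) : ℂ) * G ‖x‖ := by
    intro i
    have hball : {x : EuclideanSpace ℝ (Fin (k + 1)) | 0 < ‖x‖ ∧ ‖x‖ < ρ} ∈ 𝓝 m :=
      IsOpen.mem_nhds ((isOpen_lt continuous_const continuous_norm).inter
        (isOpen_lt continuous_norm continuous_const)) ⟨by rw [hm]; exact ht0, by rwa [hm]⟩
    filter_upwards [hball] with x hx
    have hR0 : 0 < ρ * Real.log ((ρ + ‖x‖) / (ρ - ‖x‖)) :=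
      mul_pos hρ (Real.log_pos ((one_lt_div (by linarith [hx.2])).2 (by linarith [hx.1])))
    have hp := partialDeriv_radial (norm_pos_iff.1 hx.1)
      (g := fun s => φ (ρ * Real.log ((ρ + s) / (ρ - s))))
      ((h1 _ hR0).scomp ‖x‖ (hasDerivAt_radius hx.1 hx.2)) i
    have hd : 0 < ρ ^ 2 - ‖x‖ ^ 2 := by
      rw [sq_sub_sq]; exact mul_pos (by linarith [hx.1]) (by linarith [hx.2])
    have hcx : ((2 * ρ ^ 2 / (ρ ^ 2 - ‖x‖ ^ 2) : ℝ) : ℂ) ≠ 0 := by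
      have : 0 < 2 * ρ ^ 2 / (ρ ^ 2 - ‖x‖ ^ 2) := by positivity
      exact_mod_cast this.ne'
    have hnx : ((‖x‖ : ℝ) : ℂ) ≠ 0 := by exact_mod_cast hx.1.ne'
    simp only [hyperbolicRadius, conformalFactor] at hp ⊢
    rw [hp]
    simp only [hG, Complex.real_smul]
    generalize 2 * ρ ^ 2 / (ρ ^ 2 - ‖x‖ ^ 2) = d at *
    push_cast
    field_simp
    ring
  have hsum : ∑ i : Fin (k + 1), partialDeriv i
      (fun x => ((conformalFactor ρ x ^ (k + 1) * (conformalFactor ρ x ^ 2)⁻¹ : ℝ) : ℂ)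
        * partialDeriv i (fun x => φ (hyperbolicRadius ρ x)) x) m =
      ∑ i : Fin (k + 1), partialDeriv i (fun x => ((x i : ℝ) : ℂ) * G ‖x‖) m :=
    Finset.sum_congr rfl fun i _ => by
      rw [partialDeriv, (hev i).fderiv_eq, partialDeriv]
  have hGt : G t = ((c ^ k / t : ℝ) : ℂ) * φ' r := by simp only [hG, hRt, ← hc]
  have hcf : conformalFactor ρ m = c := by rw [conformalFactor, hm]
  rw [hyperbolicLaplacian, hsum, sum_partialDeriv_coord_mul_radial hm0 (by rwa [hm]), hcf, hm, hGt]
  have hcoth : (k / ρ * (Real.cosh (r / ρ) / Real.sinh (r / ρ)) : ℝ) =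
      k * (t / ρ ^ 2 + (t * c)⁻¹) := by
    rw [hc, ht, ballRadius_coth hρ hr]; ring
  rw [hcoth]
  have hc' : (c : ℂ) ≠ 0 := by exact_mod_cast hcpos.ne'
  have ht' : (t : ℂ) ≠ 0 := by exact_mod_cast ht0.ne'
  have hρ' : (ρ : ℂ) ≠ 0 := by exact_mod_cast hρ.ne'
  clear_value c t
  push_cast
  field_simp
  ring

/-- An eigenfunction on the ball that depends only on the distance from the origin solves the
radial equation in geodesic polar coordinates. -/
theorem IsRadialEigenfunction.isPolarEigenfunction {k : ℕ} {ρ : ℝ} (hρ : 0 < ρ) {μ : ℂ}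
    {φ : ℝ → ℂ} (h : IsRadialEigenfunction k ρ μ φ) : IsPolarEigenfunction k ρ μ φ := by
  set e : EuclideanSpace ℝ (Fin (k + 1)) := EuclideanSpace.single 0 1 with he
  have hnorm : ∀ t : ℝ, ‖t • e‖ = |t| := fun t => by simp [he, norm_smul]
  have hmem : ∀ r, ballRadius ρ r • e ∈ Metric.ball (0 : EuclideanSpace ℝ (Fin (k + 1))) ρ :=
    fun r => by rw [mem_ball_zero_iff, hnorm]; exact abs_ballRadius_lt hρ r
  have hrad : ∀ r, 0 ≤ r → hyperbolicRadius ρ (ballRadius ρ r • e) = r := fun r hr => by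
    rw [hyperbolicRadius, hnorm, abs_of_nonneg (ballRadius_nonneg hρ hr), radius_ballRadius hρ]
  -- Restriction to a diameter: `F` is `C²` on all of `ℝ`, whereas `φ` is arbitrary at negative
  -- arguments. They agree on `[0, ∞)`.
  set F : ℝ → ℂ := fun r => φ (hyperbolicRadius ρ (ballRadius ρ r • e)) with hF
  have hFφ : ∀ r, 0 ≤ r → F r = φ r := fun r hr => by rw [hF]; simp only [hrad r hr]
  have hFs : ContDiff ℝ 2 F :=
    h.contDiffOn.comp_contDiff ((contDiff_ballRadius ρ).smul contDiff_const) hmem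
  have hev : ∀ r, 0 < r → φ =ᶠ[𝓝 r] F := fun r hr => by
    filter_upwards [Ioi_mem_nhds hr] with s hs using (hFφ s (le_of_lt hs)).symm
  have h1 : ∀ r, 0 < r → HasDerivAt φ (deriv φ r) r := fun r hr =>
    ((hFs.differentiable two_ne_zero r).congr_of_eventuallyEq (hev r hr)).hasDerivAt
  have h2 : ∀ r, 0 < r → HasDerivAt (deriv φ) (deriv (deriv φ) r) r := fun r hr =>
    ((hFs.differentiable_deriv_two r).congr_of_eventuallyEq (hev r hr).deriv).hasDerivAt
  refine ⟨?_, fun r hr => (h1 r hr).differentiableAt.differentiableWithinAt,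
    fun r hr => (h2 r hr).differentiableAt.differentiableWithinAt, fun r hr => ?_⟩
  · exact hFs.continuous.continuousAt.continuousWithinAt.congr
      (fun r hr => (hFφ r hr).symm) (hFφ 0 le_rfl).symm
  · have h3 := h.eigen _ (hmem r)
    rw [hyperbolicLaplacian_radial hρ hr h1 (h2 r hr)
      (by rw [hnorm, abs_of_pos (ballRadius_pos hρ hr)]), hrad r hr.le] at h3
    exact h3

end

/-! ### The one radius theorem -/

theorem sphericalMean_zero (k : ℕ) (α : ℂ) :
    sphericalMean k α 0 = ((∫ θ in (0 : ℝ)..Real.pi, Real.sin θ ^ (k - 1) : ℝ) : ℂ) := by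
  rw [sphericalMean, ← intervalIntegral.integral_ofReal]
  simp [poissonPow, invPoissonKernel]

theorem poissonPow_add_poissonPow (k : ℕ) (α : ℂ) (t θ : ℝ) :
    poissonPow α t θ + poissonPow (k - α) t θ =
      2 * ((Real.exp (-(k / 2) * Real.log (invPoissonKernel t θ)) : ℝ) : ℂ) *
        Complex.cosh ((α - k / 2) * (Real.log (invPoissonKernel t θ) : ℝ)) := by
  have h := Complex.two_cosh ((α - k / 2) * (Real.log (invPoissonKernel t θ) : ℝ))
  rw [mul_comm (2 : ℂ), mul_assoc, h, mul_add, poissonPow, poissonPow, Complex.ofReal_exp,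
    ← Complex.exp_add, ← Complex.exp_add, add_comm]
  push_cast
  ring_nf

/-- The symmetric integral representation of normalised polar eigenfunctions. -/
theorem IsPolarEigenfunction.integral_representation {k : ℕ} (hk : 1 ≤ k) {α : ℂ} {φ : ℝ → ℂ}
    (h : IsPolarEigenfunction k 1 (α * k - α ^ 2) φ) (h0 : φ 0 = 1) {t : ℝ} (ht : 0 < t) :
    2 * ((∫ θ in (0 : ℝ)..Real.pi, Real.sin θ ^ (k - 1) : ℝ) : ℂ) * φ t =
      ∫ θ in (0 : ℝ)..Real.pi,
        2 * ((Real.exp (-(k / 2) * Real.log (invPoissonKernel t θ)) : ℝ) : ℂ) *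
        Complex.cosh ((α - k / 2) * (Real.log (invPoissonKernel t θ) : ℝ)) *
        ((Real.sin θ ^ (k - 1) : ℝ) : ℂ) := by
  have e1 := h.mul_eq hk (isPolarEigenfunction_sphericalMean hk α) h0 ht
  -- The parameters `α` and `k - α` have the same eigenvalue and their means have the same value at
  -- `0`.
  have e2 := h.mul_eq hk (ψ := sphericalMean k (k - α)) (by
    have := isPolarEigenfunction_sphericalMean hk (k - α)
    rwa [show ((k : ℂ) - α) * k - (k - α) ^ 2 = α * k - α ^ 2 by ring] at this) h0 ht
  rw [sphericalMean_zero] at e1 e2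
  have hc : ∀ β, IntervalIntegrable
      (fun θ => poissonPow β t θ * ((Real.sin θ ^ (k - 1) : ℝ) : ℂ))
      MeasureTheory.volume 0 Real.pi := fun β => by
    have := Continuous.poissonPow β (continuous_const (y := t)) continuous_id
    exact Continuous.intervalIntegrable (this.mul (by fun_prop)) _ _
  have e3 : 2 * ((∫ θ in (0 : ℝ)..Real.pi, Real.sin θ ^ (k - 1) : ℝ) : ℂ) * φ t =
      sphericalMean k α t + sphericalMean k (k - α) t := by rw [← e1, ← e2]; ring
  rw [e3, sphericalMean, sphericalMean, ← intervalIntegral.integral_add (hc _) (hc _)]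
  simp only [← add_mul, poissonPow_add_poissonPow]

theorem cosh_sub_cosh_eq (z w : ℂ) :
    Complex.cosh z - Complex.cosh w =
      2 * (Complex.sinh ((z + w) / 2) * Complex.sinh ((z - w) / 2)) := by
  have h1 := Complex.cosh_add ((z + w) / 2) ((z - w) / 2)
  have h2 := Complex.cosh_sub ((z + w) / 2) ((z - w) / 2)
  rw [show (z + w) / 2 + (z - w) / 2 = z by ring] at h1
  rw [show (z + w) / 2 - (z - w) / 2 = w by ring] at h2
  rw [h1, h2]
  ring

theorem IsPolarEigenfunction.ne_of_curvature_neg_one {k : ℕ} (hk : 1 ≤ k) {α β : ℂ}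
    {φ ψ : ℝ → ℂ} (hφ : IsPolarEigenfunction k 1 (α * k - α ^ 2) φ)
    (hψ : IsPolarEigenfunction k 1 (β * k - β ^ 2) ψ) (hφ0 : φ 0 = 1) (hψ0 : ψ 0 = 1)
    (hαβ : α * k - α ^ 2 ≠ β * k - β ^ 2) {t : ℝ} (ht : 0 < t)
    (hα : |α.im| * t ≤ Real.pi / 2) (hβ : |β.im| * t ≤ Real.pi / 2) : φ t ≠ ψ t := by
  intro heq
  set z : ℂ := ((α - k / 2) + (β - k / 2)) / 2 with hz
  set w : ℂ := ((α - k / 2) - (β - k / 2)) / 2 with hw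
  -- Completing the square, `αk - α² = k²/4 - (α - k/2)²`, so distinct eigenvalues mean `zw ≠ 0`.
  have hzw : β * k - β ^ 2 - (α * k - α ^ 2) = 4 * z * w := by rw [hz, hw]; ring
  have hzw0 : z ≠ 0 ∧ w ≠ 0 := by
    constructor <;> rintro h0 <;> rw [h0] at hzw <;> apply hαβ <;> linear_combination -hzw
  have hzim : z.im = (α.im + β.im) / 2 := by
    rw [hz, Complex.div_ofNat_im]; simp
  have hwim : w.im = (α.im - β.im) / 2 := by
    rw [hw, Complex.div_ofNat_im]; simp
  have hzt : |z.im| * t ≤ Real.pi / 2 := by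
    have : |z.im| ≤ (|α.im| + |β.im|) / 2 := by
      rw [hzim, abs_div, abs_two]; linarith [abs_add_le α.im β.im]
    nlinarith [mul_le_mul_of_nonneg_right this ht.le]
  have hwt : |w.im| * t ≤ Real.pi / 2 := by
    have : |w.im| ≤ (|α.im| + |β.im|) / 2 := by
      rw [hwim, abs_div, abs_two]; linarith [abs_sub α.im β.im]
    nlinarith [mul_le_mul_of_nonneg_right this ht.le]
  obtain ⟨u, hu0, hu1⟩ := exists_sinhProductInHalfPlane hzw0.1 hzw0.2 hzt hwt
  set L : ℝ → ℝ := fun θ => Real.log (invPoissonKernel t θ) with hL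
  have hLc : Continuous L := (Continuous.invPoissonKernel continuous_const continuous_id).log
    fun θ => (invPoissonKernel_pos t θ).ne'
  -- `u` times the difference of the two integrands; `4` combines the `2` of the representation with
  -- the `2` of `cosh_sub_cosh_eq`.
  set I : ℝ → ℂ := fun θ => ((4 * Real.exp (-(k / 2) * L θ) * Real.sin θ ^ (k - 1) : ℝ) : ℂ) *
    (u * (Complex.sinh (z * L θ) * Complex.sinh (w * L θ))) with hI
  have hIc : Continuous I := by
    rw [hI]
    fun_prop
  have hI0 : ∫ θ in (0 : ℝ)..Real.pi, I θ = 0 := by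
    have e1 := hφ.integral_representation hk hφ0 ht
    have e2 := hψ.integral_representation hk hψ0 ht
    rw [heq, e2, ← sub_eq_zero, ← intervalIntegral.integral_sub] at e1
    · rw [← mul_zero (-u), ← e1, ← intervalIntegral.integral_const_mul]
      refine intervalIntegral.integral_congr fun θ _ => ?_
      have h := cosh_sub_cosh_eq ((α - k / 2) * (L θ : ℂ)) ((β - k / 2) * (L θ : ℂ))
      rw [← add_mul, ← sub_mul, mul_div_right_comm, mul_div_right_comm, ← hz, ← hw] at h
      simp only [hI, hL] at h ⊢
      push_cast
      linear_combination (-2 * u * Complex.exp (-(k / 2) *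
        (Real.log (invPoissonKernel t θ) : ℝ)) * Complex.sin θ ^ (k - 1)) * h
    all_goals
      refine Continuous.intervalIntegrable ?_ _ _
      change Continuous fun θ => 2 * ((Real.exp (-(k / 2) * L θ) : ℝ) : ℂ) *
        Complex.cosh (_ * (L θ : ℝ)) * ((Real.sin θ ^ (k - 1) : ℝ) : ℂ)
      fun_prop
  have hre : ∀ θ, (I θ).re = (4 * Real.exp (-(k / 2) * L θ) * Real.sin θ ^ (k - 1)) *
      (u * (Complex.sinh (z * L θ) * Complex.sinh (w * L θ))).re := fun θ => by
    rw [hI]; exact Complex.re_ofReal_mul _ _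
  have hpos : 0 < ∫ θ in (0 : ℝ)..Real.pi, (I θ).re := by
    refine intervalIntegral.integral_pos Real.pi_pos
      (Complex.continuous_re.comp hIc).continuousOn ?_ ⟨Real.pi / 2, ?_, ?_⟩
    · intro θ hθ
      rw [hre]
      have hsin := Real.sin_nonneg_of_nonneg_of_le_pi hθ.1.le hθ.2
      refine mul_nonneg (by positivity) ?_
      have hab := abs_log_invPoissonKernel_le ht.le θ
      rcases le_total 0 (L θ) with h0 | h0
      · exact hu0 _ h0 ((le_abs_self _).trans hab)
      -- The product of the two `sinh` factors is even in `L`.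
      · have := hu0 (-L θ) (neg_nonneg.2 h0) ((neg_le_abs _).trans hab)
        simpa [Complex.sinh_neg] using this
    · constructor <;> linarith [Real.pi_pos]
    · rw [hre]
      -- At the equator `L = log (cosh t)` lies strictly between `0` and `t`, where the half-plane
      -- inequality is strict.
      have hcosh : invPoissonKernel t (Real.pi / 2) = Real.cosh t := by simp [invPoissonKernel]
      have h1 : 0 < L (Real.pi / 2) := by
        rw [hL]; simp only [hcosh]; exact Real.log_pos (Real.one_lt_cosh.2 ht.ne')
      have h2 : L (Real.pi / 2) < t := by
        rw [hL]; simp only [hcosh]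
        rw [Real.log_lt_iff_lt_exp (Real.cosh_pos t), ← Real.cosh_add_sinh]
        linarith [Real.sinh_pos_iff.2 ht]
      refine mul_pos ?_ (hu1 _ h1 h2)
      rw [Real.sin_pi_div_two, one_pow, mul_one]
      positivity
  have hc := Complex.reCLM.intervalIntegral_comp_comm
    (hIc.intervalIntegrable (μ := MeasureTheory.volume) 0 Real.pi)
  simp only [Complex.reCLM_apply, hI0, Complex.zero_re] at hc
  linarith

theorem IsPolarEigenfunction.ne_of_mem_oneRadiusInterval {k : ℕ} (hk : 1 ≤ k) {ρ κ : ℝ}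
    (hρ : 0 < ρ) (hκ : κ = -1 / ρ ^ 2) {μ ν : ℂ} (hμν : μ ≠ ν) {φ ψ : ℝ → ℂ}
    (hφ : IsPolarEigenfunction k ρ μ φ) (hψ : IsPolarEigenfunction k ρ ν ψ)
    (hφ0 : φ 0 = 1) (hψ0 : ψ 0 = 1) {α β : ℂ} (hα : μ = -κ * (α * k - α ^ 2))
    (hβ : ν = -κ * (β * k - β ^ 2)) {r : ℝ}
    (hr : r ∈ oneRadiusInterval ρ (max |α.im| |β.im|)) : φ r ≠ ψ r := by
  have hρ' : (ρ : ℂ) ≠ 0 := by exact_mod_cast hρ.ne'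
  have hα' : (ρ : ℂ) ^ 2 * μ = α * k - α ^ 2 := by
    rw [hα, hκ]; push_cast; field_simp
  have hβ' : (ρ : ℂ) ^ 2 * ν = β * k - β ^ 2 := by
    rw [hβ, hκ]; push_cast; field_simp
  have hne : α * k - α ^ 2 ≠ β * k - β ^ 2 := by
    rw [← hα', ← hβ']
    exact fun h => hμν (mul_left_cancel₀ (pow_ne_zero 2 hρ') h)
  have hφ1 := hφ.rescale hρ
  have hψ1 := hψ.rescale hρ
  rw [hα'] at hφ1
  rw [hβ'] at hψ1
  obtain ⟨hr0, hp⟩ : 0 < r ∧ max |α.im| |β.im| * (r / ρ) ≤ Real.pi / 2 := by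
    have hp0 : 0 ≤ max |α.im| |β.im| := (abs_nonneg _).trans (le_max_left _ _)
    generalize max |α.im| |β.im| = p at *
    rw [oneRadiusInterval] at hr
    split_ifs at hr with hp
    · exact ⟨hr, by rw [hp, zero_mul]; linarith [Real.pi_pos]⟩
    · refine ⟨hr.1, ?_⟩
      have hp1 : 0 < p := hp0.lt_of_ne' hp
      have h2 := hr.2
      rw [le_div_iff₀ (by positivity)] at h2
      rw [mul_div_assoc', div_le_iff₀ hρ]
      linarith
  have ht : 0 < r / ρ := div_pos hr0 hρ
  have h := hφ1.ne_of_curvature_neg_one hk hψ1 (by simpa using hφ0) (by simpa using hψ0) hne ht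
    ((mul_le_mul_of_nonneg_right (le_max_left _ _) ht.le).trans hp)
    ((mul_le_mul_of_nonneg_right (le_max_right _ _) ht.le).trans hp)
  simpa [mul_div_cancel₀ r hρ.ne'] using h

/-- Real eigenvalues up to the bottom of the spectrum have a real spectral parameter. -/
theorem exists_real_spectral_parameter {k : ℕ} {ρ κ : ℝ} (hρ : 0 < ρ) (hκ : κ = -1 / ρ ^ 2)
    {μ : ℂ} (him : μ.im = 0) (hre : μ.re ≤ -κ * k ^ 2 / 4) :
    ∃ α : ℂ, α.im = 0 ∧ μ = -κ * (α * k - α ^ 2) := by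
  have hd : 0 ≤ (k : ℝ) ^ 2 / 4 - ρ ^ 2 * μ.re := by
    have h := mul_le_mul_of_nonneg_left hre (sq_nonneg ρ)
    have e : ρ ^ 2 * (-κ * k ^ 2 / 4) = (k : ℝ) ^ 2 / 4 := by rw [hκ]; field_simp
    linarith
  -- The larger root of `a k - a² = ρ² μ`, real exactly below the spectral bound.
  set a : ℝ := k / 2 + √((k : ℝ) ^ 2 / 4 - ρ ^ 2 * μ.re) with ha
  refine ⟨(a : ℂ), Complex.ofReal_im a, ?_⟩
  have h1 : a * k - a ^ 2 = ρ ^ 2 * μ.re := by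
    rw [ha]; linear_combination -Real.sq_sqrt hd
  have h2 : μ.re = -κ * (a * k - a ^ 2) := by
    rw [h1, hκ]; field_simp
  have h3 : μ = (μ.re : ℂ) := Complex.ext rfl (by simpa using him)
  rw [h3, h2]
  push_cast
  rfl

theorem mainTheorem2 (k : ℕ) (hk : 1 ≤ k) (ρ κ : ℝ) (hρ : 0 < ρ) (hκ : κ = -1 / ρ ^ 2)
    (μ ν : ℂ) (hμν : μ ≠ ν) (φ ψ : ℝ → ℂ)
    -- both the intrinsic notion on the ball and the equation in polar coordinates are covered
    (h : (IsRadialEigenfunction k ρ μ φ ∧ IsRadialEigenfunction k ρ ν ψ) ∨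
      (IsPolarEigenfunction k ρ μ φ ∧ IsPolarEigenfunction k ρ ν ψ))
    (hφ : φ 0 = 1) (hψ : ψ 0 = 1) :
    (∀ α β : ℂ, μ = -κ * (α * k - α ^ 2) → ν = -κ * (β * k - β ^ 2) →
      ∀ r ∈ oneRadiusInterval ρ (max |α.im| |β.im|), φ r ≠ ψ r) ∧
    (μ.im = 0 → ν.im = 0 → μ.re ≤ -κ * k ^ 2 / 4 → ν.re ≤ -κ * k ^ 2 / 4 →
      ∀ r : ℝ, 0 < r → φ r ≠ ψ r) := by
  have h' : IsPolarEigenfunction k ρ μ φ ∧ IsPolarEigenfunction k ρ ν ψ :=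
    h.elim (fun h => ⟨h.1.isPolarEigenfunction hρ, h.2.isPolarEigenfunction hρ⟩) id
  refine ⟨fun α β hα hβ r hr => h'.1.ne_of_mem_oneRadiusInterval hk hρ hκ hμν h'.2 hφ hψ hα hβ hr,
    fun hμi hνi hμ hν r hr => ?_⟩
  obtain ⟨α, hαi, hα⟩ := exists_real_spectral_parameter hρ hκ hμi hμ
  obtain ⟨β, hβi, hβ⟩ := exists_real_spectral_parameter hρ hκ hνi hν
  refine h'.1.ne_of_mem_oneRadiusInterval hk hρ hκ hμν h'.2 hφ hψ hα hβ ?_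
  simpa [oneRadiusInterval, hαi, hβi] using hr
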